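/- Let $G$ be a second countable locally compact Hausdorff group. Let $(S,m)$ be a standard Borel space with a $\sigma$-finite measure, on which $G$ acts measurably, preserving $m$, and let $\Pr_m(S)$ denote the set of probability measures on $S$ that are absolutely continuous with respect to $m$. Suppose that the action of $G$ on $(S,m)$ is *proper*: there is a measurable $G$-equivariant map $L$ from $\Pr_m(S)$ to the space $\Pr(G)$ of probability measures on $G$ which is uniformly continuous in total variation (for instance $L(\nu)=\int_S\kappa_s\,d\nu(s)$ for a measurable equivariant family $s\mapsto\kappa_s\in\Pr(G)$). Let $P$ be a $G$-invariant Markov operator on $L^\infty(S,m)$, i.e. $Pf(s)=\int f\,d\pi_s$ for a Borel family $\{\pi_s\}_{s\in S}$ of probability measures on $S$ such that $\int\pi_s\,dm(s)$ is absolutely continuous with respect to $m$ and, for every $g\in G$, $\pi_{gs}=g\pi_s$ for $m$-a.e. $s$. A *positive harmonic function* is a Borel function $\varphi:S\to[0,\infty)$, not $m$-a.e. zero, with $P\varphi=\varphi$ $m$-a.e. It is *minimal* if every Borel function $\psi$ with $0\le\psi\le\varphi$ and $P\psi=\psi$ $m$-a.e. is $m$-a.e. a constant multiple of $\varphi$.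 The *projective class* of $\varphi$ consists of the functions equal $m$-a.e. to $c\varphi$ for some constant $c>0$. Let $(X,\mu)$ be another standard Borel space with a $\sigma$-finite measure and a measurable, measure class preserving action of $G$. Suppose that there is a measurable $G$-equivariant map assigning to points $x\in X$ projective classes of minimal positive harmonic functions $\varphi_x$; that is, there is a Borel function $(x,s)\mapsto\varphi_x(s)$ on $X\times S$ such that $\varphi_x$ is minimal positive harmonic for $\mu$-a.e. $x$ and, for every $g\in G$ and $\mu$-a.e. $x$, the functions $\varphi_{gx}$ and $s\mapsto\varphi_x(g^{-1}s)$ define the same projective class. Then the action of $G$ on $(X,\mu)$ is *amenable*: with $\lambda$ a left Haar measure on $G$, there is a positive, unital, $L^\infty(X,\mu)$-linear map $$\Pi:L^\infty(X\times G,\mu\otimes\lambda)\to L^\infty(X,\mu)$$ (an invariant mean for the action groupoid, where $(x,g)$ stands for the morphism with target $x$ and source $g^{-1}x$) such that $\Pi(k*F)=k*\Pi(F)$ for all $F\in L^\infty(X\times G,\mu\otimes\lambda)$ and all Borel functions $k\ge 0$ on $X\times G$ with $\operatorname{ess\,sup}_x\int k(x,h)\,d\lambda(h)<\infty$, where $$(k*F)(x,g)=\int_G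 F(h^{-1}x,h^{-1}g)\,k(x,h)\,d\lambda(h),\qquad (k*f)(x)=\int_G f(h^{-1}x)\,k(x,h)\,d\lambda(h).$$ -/

import Mathlib

open MeasureTheory ProbabilityTheory
open scoped ENNReal NNReal

noncomputable section

/-- Probability measures on `S` that are absolutely continuous with respect to `m`. As a subtype of
`Measure S` it carries the usual measurable structure, generated by the evaluations `ν ↦ ν A`. -/
abbrev AcProb {S : Type*} [MeasurableSpace S] (m : Measure S) : Type _ :=
  {ν : Measure S // IsProbabilityMeasure ν ∧ ν ≪ m}

/-- A measure preserving action of `G` on `(S, m)` is proper if probability measures `ν ≪ m` can be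
lifted from `S` to probability measures on `G` measurably and equivariantly, the lift being
uniformly continuous in total variation. (Integration of an equivariant measurable system
`s ↦ κ s` of probability measures on `G`, `ν ↦ ∫ κ s dν(s)`, is such a lift.) -/
def IsProperAction (G : Type*) {S : Type*} [Group G] [MeasurableSpace G] [MeasurableSpace S]
    [MulAction G S] (m : Measure S) : Prop :=
  ∃ L : AcProb m → Measure G,
    Measurable L ∧
    (∀ ν, IsProbabilityMeasure (L ν)) ∧
    (∀ (g : G) (ν ν' : AcProb m), ν'.1 = ν.1.map (fun s => g • s) →
      L ν' = (L ν).map (fun h => g * h)) ∧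
    (∀ ε : ℝ, 0 < ε → ∃ δ : ℝ, 0 < δ ∧ ∀ ν ν' : AcProb m,
      (∀ A, MeasurableSet A → |ν.1.real A - ν'.1.real A| ≤ δ) →
      ∀ B, MeasurableSet B → |(L ν).real B - (L ν').real B| ≤ ε)

/-- `P` is (the system of transition probabilities of) a `G`-invariant Markov operator on
`L^∞(S, m)`. The condition `adapted` says that the operator is well defined mod `m`, and `invariant`
says that it commutes with every `g ∈ G`. -/
structure IsInvariantMarkov (G : Type*) {S : Type*} [Group G] [MeasurableSpace S] [MulAction G S]
    (m : Measure S) (P : Kernel S S) : Prop where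
  markov : IsMarkovKernel P
  adapted : m.bind P ≪ m
  invariant : ∀ g : G, ∀ᵐ s ∂m, P (g • s) = (P s).map (fun t => g • t)

/-- Nonnegative Borel functions with `P f = f` (mod `m`). -/
def IsHarmonic {S : Type*} [MeasurableSpace S] (m : Measure S) (P : Kernel S S) (f : S → ℝ≥0) :
    Prop :=
  Measurable f ∧ ∀ᵐ s ∂m, ∫⁻ t, (f t : ℝ≥0∞) ∂(P s) = f s

/-- Minimal positive harmonic functions: nonzero elements `f` of the cone of nonnegative harmonic
functions such that any harmonic `0 ≤ ψ ≤ f` is proportional to `f` (everything mod `m`). -/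
def IsMinimalHarmonic {S : Type*} [MeasurableSpace S] (m : Measure S) (P : Kernel S S)
    (f : S → ℝ≥0) : Prop :=
  IsHarmonic m P f ∧ (¬ ∀ᵐ s ∂m, f s = 0) ∧
    ∀ ψ : S → ℝ≥0, IsHarmonic m P ψ → (∀ᵐ s ∂m, ψ s ≤ f s) →
      ∃ c : ℝ≥0, ∀ᵐ s ∂m, ψ s = c * f s

/-- Two functions define the same projective class (mod `m`). -/
def ProjEq {S : Type*} [MeasurableSpace S] (m : Measure S) (f₁ f₂ : S → ℝ≥0) : Prop :=
  ∃ c : ℝ≥0, 0 < c ∧ ∀ᵐ s ∂m, f₁ s = c * f₂ s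

/-- Amenability of a measure class preserving action of `G` on `(X, μ)`: existence of an invariant
mean `L^∞(𝐆, λ ⋆ μ) → L^∞(X, μ)` for the measured groupoid `𝐆` of the action.

The morphism `(x, g, g⁻¹ x)` of `𝐆` with target `x` and source `g⁻¹ x` is written as `(x, g)`, so
that `λ ⋆ μ` is `μ ⊗ Haar`. A bounded system of finite measures on the target fibres, absolutely
continuous with respect to the Haar system, is given by its density `k`; its convolution with
functions on `𝐆` and on `X` is `(k ∗ F)(x, g) = ∫ F (h⁻¹ x, h⁻¹ g) k (x, h) dh` and
`(k ∗ f)(x) = ∫ f (h⁻¹ x) k (x, h) dh`. -/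
def IsAmenableAction (G : Type*) {X : Type*} [Group G] [TopologicalSpace G] [IsTopologicalGroup G]
    [LocallyCompactSpace G] [MeasurableSpace G] [BorelSpace G] [MeasurableSpace X] [MulAction G X]
    (μ : Measure X) : Prop :=
  ∃ M : Lp ℝ ∞ (μ.prod (Measure.haar : Measure G)) →ₗ[ℝ] Lp ℝ ∞ μ,
    -- positive
    (∀ F, (∀ᵐ p ∂(μ.prod (Measure.haar : Measure G)), 0 ≤ F p) → ∀ᵐ x ∂μ, 0 ≤ M F x) ∧
    -- normalized
    (∀ F, (∀ᵐ p ∂(μ.prod (Measure.haar : Measure G)), F p = 1) → ∀ᵐ x ∂μ, M F x = 1) ∧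
    -- linear over the functions on the space of objects
    (∀ (a : Lp ℝ ∞ μ) (F F' : Lp ℝ ∞ (μ.prod (Measure.haar : Measure G))),
      (∀ᵐ p ∂(μ.prod (Measure.haar : Measure G)), F' p = a p.1 * F p) →
      ∀ᵐ x ∂μ, M F' x = a x * M F x) ∧
    -- invariant
    (∀ k : X × G → ℝ≥0, Measurable k →
      (∃ C : ℝ≥0, ∀ᵐ x ∂μ, ∫⁻ h, (k (x, h) : ℝ≥0∞) ∂(Measure.haar : Measure G) ≤ C) →
      ∀ F F' : Lp ℝ ∞ (μ.prod (Measure.haar : Measure G)),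
        (∀ᵐ p ∂(μ.prod (Measure.haar : Measure G)),
          F' p = ∫ h, F (h⁻¹ • p.1, h⁻¹ * p.2) * (k (p.1, h) : ℝ) ∂(Measure.haar : Measure G)) →
        ∀ᵐ x ∂μ, M F' x = ∫ h, M F (h⁻¹ • x) * (k (x, h) : ℝ) ∂(Measure.haar : Measure G))

end

/-! Minimality of `φ x` says that the Doob transform of `P` by `φ x` has only constant bounded
harmonic functions. Hence the Cesàro averages of its `n`-step distributions forget the initial
distribution, even in total variation. `P` commutes with `G` and `x ↦ φ x` is projectively
equivariant, so translating an average attached to `x` by `g` gives an average attached to `g • x`,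
only with another initial distribution. This produces maps from `X` to probability measures on `S`
that are equivariant in the limit. Properness carries them to `G`, giving a Reiter sequence, and a
weak* ultralimit of averages along it is the invariant mean.

Loss of memory is `eventually_abs_doobCesaro_sub_le`. It rests on `exists_tendsto_doobCesaro`, where
a weak* limit of normalized potentials is a harmonic function below `φ`, hence `c * φ`. The sets
tested there may vary with `n`; this freedom upgrades convergence on sets to convergence in total
variation.

The remaining links are `IsInvariantMarkov.map_doobCesaro` (equivariance),
`IsProperAction.exists_isAsymptoticallyInvariant` (passage to `G`) and
`IsAsymptoticallyInvariant.isAmenableAction` (from Reiter sequence to mean). -/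

open Filter Topology

/-! ### Weak* ultralimits of bounded functions. -/

/-- Ultralimits of bounded sequences in a Hilbert space exist in the weak topology. -/
theorem exists_weak_ultralimit_of_norm_le {E : Type*} [NormedAddCommGroup E]
    [InnerProductSpace ℝ E] [CompleteSpace E] (U : Ultrafilter ℕ) (w : ℕ → E) (R : ℝ)
    (hw : ∀ n, ‖w n‖ ≤ R) :
    ∃ v : E, ∀ z : E, Tendsto (fun n => inner ℝ (w n) z) U (𝓝 (inner ℝ v z)) := by
  -- Banach–Alaoglu in the dual, transported by the Riesz isomorphism.
  have hc := WeakDual.isCompact_closedBall (𝕜 := ℝ) (E := E) 0 R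
  let W : ℕ → WeakDual ℝ E := fun n => StrongDual.toWeakDual (InnerProductSpace.toDual ℝ E (w n))
  obtain ⟨x, -, hx⟩ := hc.ultrafilter_le_nhds (U.map W) (by
    rw [le_principal_iff]
    refine Filter.Eventually.of_forall (f := (U : Filter ℕ)) fun n => ?_
    simp [W, hw n])
  refine ⟨(InnerProductSpace.toDual ℝ E).symm (WeakDual.toStrongDual x), fun z => ?_⟩
  have h1 : Tendsto W U (𝓝 x) := hx
  have h2 := (WeakDual.eval_continuous (𝕜 := ℝ) (E := E) z).continuousAt.tendsto.comp h1
  simpa [W, Function.comp_def] using h2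

theorem integral_le_mul_measureReal {X : Type*} [MeasurableSpace X] {ν : Measure X}
    [IsFiniteMeasure ν] {u : X → ℝ} {C : ℝ} (hb : ∀ᵐ x ∂ν, |u x| ≤ C) :
    |∫ x, u x ∂ν| ≤ C * ν.real Set.univ := by
  simpa using norm_integral_le_of_norm_le_const (f := u) (μ := ν) (C := C) (by simpa using hb)

theorem integrable_of_abs_le {X : Type*} [MeasurableSpace X] {ν : Measure X}
    [IsFiniteMeasure ν] {u : X → ℝ} {C : ℝ} (hu : Measurable u) (hb : ∀ᵐ x ∂ν, |u x| ≤ C) :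
    Integrable u ν :=
  Integrable.of_bound hu.aestronglyMeasurable C (by simpa using hb)

/-- Ultralimits of bounded sequences of functions with respect to the weak* topology of `L^∞`. -/
theorem exists_weakStar_ultralimit {X : Type*} [MeasurableSpace X] (μ : Measure X) [SFinite μ]
    (U : Ultrafilter ℕ) (C : ℝ) (hC : 0 ≤ C) (u : ℕ → X → ℝ) (hu : ∀ n, Measurable (u n))
    (hb : ∀ n, ∀ᵐ x ∂μ, |u n x| ≤ C) :
    ∃ v : X → ℝ, Measurable v ∧ (∀ x, |v x| ≤ C) ∧ ∀ ν : Measure X, IsFiniteMeasure ν → ν ≪ μ →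
      Tendsto (fun n => ∫ x, u n x ∂ν) U (𝓝 (∫ x, v x ∂ν)) := by
  -- Over an equivalent finite measure bounded functions lie in `L²`, where weak ultralimits exist.
  obtain ⟨ν₀, hfin, hμν, hνμ⟩ := exists_isFiniteMeasure_absolutelyContinuous μ
  have hb0 : ∀ n, ∀ᵐ x ∂ν₀, |u n x| ≤ C := fun n => hνμ.ae_le (hb n)
  have hLp : ∀ n, MemLp (u n) 2 ν₀ := fun n =>
    MemLp.of_bound (hu n).aestronglyMeasurable C (by simpa using hb0 n)
  obtain ⟨v, hv⟩ := exists_weak_ultralimit_of_norm_le U (fun n => (hLp n).toLp (u n))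
    ((measureUnivNNReal ν₀ : ℝ) ^ (ENNReal.toReal 2)⁻¹ * C) (fun n => by
      exact Lp.norm_le_of_ae_bound (p := 2) (f := (hLp n).toLp (u n)) hC (by
        filter_upwards [(hLp n).coeFn_toLp, hb0 n] with x h1 h2
        rw [h1]; simpa using h2))
  have key : ∀ z : X → ℝ, MemLp z 2 ν₀ →
      Tendsto (fun n => ∫ x, u n x * z x ∂ν₀) U (𝓝 (∫ x, v x * z x ∂ν₀)) := by
    intro z hz
    have h := hv (hz.toLp z)
    have e1 : ∀ n, inner ℝ ((hLp n).toLp (u n)) (hz.toLp z) = ∫ x, u n x * z x ∂ν₀ := by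
      intro n
      rw [L2.inner_def]
      refine integral_congr_ae ?_
      filter_upwards [(hLp n).coeFn_toLp, hz.coeFn_toLp] with x h1 h2
      rw [h1, h2]; simp [mul_comm]
    have e2 : inner ℝ v (hz.toLp z) = ∫ x, v x * z x ∂ν₀ := by
      rw [L2.inner_def]
      refine integral_congr_ae ?_
      filter_upwards [hz.coeFn_toLp] with x h2
      rw [h2]; simp [mul_comm]
    simpa only [e1, e2] using h
  have keyset : ∀ s, MeasurableSet s →
      Tendsto (fun n => ∫ x in s, u n x ∂ν₀) U (𝓝 (∫ x in s, v x ∂ν₀)) := by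
    intro s hs
    have := key (s.indicator fun _ => 1) (memLp_indicator_const 2 hs 1 (Or.inr (by simp)))
    have e : ∀ f : X → ℝ, ∫ x, f x * s.indicator (fun _ => (1 : ℝ)) x ∂ν₀ = ∫ x in s, f x ∂ν₀ := by
      intro f
      rw [← integral_indicator hs]
      congr 1
      ext x
      by_cases hx : x ∈ s <;> simp [hx]
    simpa only [e] using this
  have hvi : Integrable v ν₀ := (Lp.memLp v).integrable (by norm_num)
  have hui : ∀ n, Integrable (u n) ν₀ := fun n => integrable_of_abs_le (hu n) (hb0 n)
  have hup : ∀ᵐ x ∂ν₀, v x ≤ C := by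
    refine ae_le_of_forall_setIntegral_le hvi (integrable_const C) fun s hs _ => ?_
    refine le_of_tendsto (keyset s hs) (Eventually.of_forall fun n => ?_)
    exact integral_mono_ae (hui n).integrableOn (integrable_const C)
      (ae_restrict_of_ae ((hb0 n).mono fun x hx => (abs_le.1 hx).2))
  have hlo : ∀ᵐ x ∂ν₀, -C ≤ v x := by
    refine ae_le_of_forall_setIntegral_le (integrable_const _) hvi fun s hs _ => ?_
    refine ge_of_tendsto (keyset s hs) (Eventually.of_forall fun n => ?_)
    exact integral_mono_ae (integrable_const _) (hui n).integrableOn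
      (ae_restrict_of_ae ((hb0 n).mono fun x hx => (abs_le.1 hx).1))
  -- Clamping makes the a.e. bound hold everywhere without changing the class of `v`.
  let v' : X → ℝ := fun x => max (-C) (min C (v x))
  have hvm : Measurable v := (Lp.stronglyMeasurable v).measurable
  have hv'm : Measurable v' := measurable_const.max (measurable_const.min hvm)
  have hv'b : ∀ x, |v' x| ≤ C := fun x =>
    abs_le.2 ⟨le_max_left _ _, max_le (by linarith) (min_le_left _ _)⟩
  have hvv' : ∀ᵐ x ∂ν₀, v' x = v x := by
    filter_upwards [hup, hlo] with x h1 h2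
    simp [v', h1, h2]
  refine ⟨v', hv'm, hv'b, fun ν hν hac => ?_⟩
  have hac0 : ν ≪ ν₀ := hac.trans hμν
  -- The density of `ν` is only in `L¹`. Cut off to `A N` it is bounded, hence an admissible `L²`
  -- test function, and the tail costs at most `C * ν.real (A N)ᶜ` uniformly in `n`.
  let A : ℕ → Set X := fun N => {x | (ν.rnDeriv ν₀ x).toReal ≤ N}
  have hAm : ∀ N, MeasurableSet (A N) := fun N =>
    measurableSet_le (Measure.measurable_rnDeriv _ _).ennreal_toReal measurable_const
  have hA0 : Tendsto (fun N => ν.real (A N)ᶜ) atTop (𝓝 0) := by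
    have h := tendsto_measure_iInter_atTop (μ := ν) (s := fun N => (A N)ᶜ)
      (fun N => (hAm N).compl.nullMeasurableSet)
      (fun i j hij => Set.compl_subset_compl.2 fun x hx =>
        le_trans (show (ν.rnDeriv ν₀ x).toReal ≤ i from hx) (by exact_mod_cast hij)) ⟨0, measure_ne_top _ _⟩
    have he : ⋂ N, (A N)ᶜ = ∅ := by
      rw [← Set.compl_iUnion, Set.compl_empty_iff, Set.eq_univ_iff_forall]
      intro x
      obtain ⟨N, hN⟩ := exists_nat_ge (ν.rnDeriv ν₀ x).toReal
      exact Set.mem_iUnion.2 ⟨N, hN⟩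
    rw [he, measure_empty] at h
    simpa [Measure.real, Function.comp_def] using (ENNReal.tendsto_toReal ENNReal.zero_ne_top).comp h
  have hAlim : ∀ N, Tendsto (fun n => ∫ x in A N, u n x ∂ν) U (𝓝 (∫ x in A N, v' x ∂ν)) := by
    intro N
    let z : X → ℝ := (A N).indicator fun x => (ν.rnDeriv ν₀ x).toReal
    have hz : MemLp z 2 ν₀ := by
      refine MemLp.of_bound (((Measure.measurable_rnDeriv _ _).ennreal_toReal.indicator
        (hAm N)).aestronglyMeasurable) N (Eventually.of_forall fun x => ?_)
      by_cases hx : x ∈ A N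
      · simp only [z, Set.indicator_of_mem hx, Real.norm_eq_abs, ENNReal.abs_toReal]
        exact hx
      · simp [z, hx]
    have e : ∀ f : X → ℝ, ∫ x, f x * z x ∂ν₀ = ∫ x in A N, f x ∂ν := by
      intro f
      rw [← integral_indicator (hAm N), ← integral_rnDeriv_smul hac0]
      congr 1
      ext x
      by_cases hx : x ∈ A N <;> simp [z, hx, mul_comm]
    have h := key z hz
    rw [show ∫ x, v x * z x ∂ν₀ = ∫ x, v' x * z x ∂ν₀ from integral_congr_ae (by
      filter_upwards [hvv'] with x hx; rw [hx])] at h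
    simpa only [e] using h
  have hubν : ∀ n, ∀ᵐ x ∂ν, |u n x| ≤ C := fun n => hac.ae_le (hb n)
  have htail : ∀ (f : X → ℝ), Measurable f → (∀ᵐ x ∂ν, |f x| ≤ C) → ∀ N,
      |∫ x, f x ∂ν - ∫ x in A N, f x ∂ν| ≤ C * ν.real (A N)ᶜ := by
    intro f hf hfb N
    rw [← integral_add_compl (hAm N) (integrable_of_abs_le hf hfb), add_sub_cancel_left]
    simpa using integral_le_mul_measureReal (ν := ν.restrict (A N)ᶜ) (ae_restrict_of_ae hfb)
  rw [Metric.tendsto_nhds]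
  intro ε hε
  have hA0' : Tendsto (fun N => C * ν.real (A N)ᶜ) atTop (𝓝 0) := by
    simpa using hA0.const_mul C
  obtain ⟨N, hN⟩ := (hA0'.eventually (gt_mem_nhds (show 0 < ε / 3 by linarith))).exists
  filter_upwards [Metric.tendsto_nhds.1 (hAlim N) (ε / 3) (by linarith)] with n hn
  rw [Real.dist_eq] at hn ⊢
  have h1 := htail (u n) (hu n) (hubν n) N
  have h2 := htail v' hv'm (Eventually.of_forall hv'b) N
  rw [abs_lt] at hn ⊢
  rw [abs_le] at h1 h2
  constructor <;> linarith [hn.1, hn.2, h1.1, h1.2, h2.1, h2.2]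

/-- `v` is the limit of `u` along the filter `l` in the weak* topology of `L^∞(μ)`; the test
functions are the finite measures that are absolutely continuous with respect to `μ`. -/
def IsWeakStarLim {X : Type*} [MeasurableSpace X] (μ : Measure X) (l : Filter ℕ)
    (u : ℕ → X → ℝ) (v : X → ℝ) : Prop :=
  ∀ ν : Measure X, IsFiniteMeasure ν → ν ≪ μ →
    Tendsto (fun n => ∫ x, u n x ∂ν) l (𝓝 (∫ x, v x ∂ν))

namespace IsWeakStarLim

variable {X : Type*} [MeasurableSpace X] {μ : Measure X} {l : Filter ℕ}
  {u u' : ℕ → X → ℝ} {v v' : X → ℝ}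

theorem congr (h : IsWeakStarLim μ l u v) (hu : ∀ n, ∀ᵐ x ∂μ, u' n x = u n x) :
    IsWeakStarLim μ l u' v := by
  intro ν hν hac
  have e : ∀ n, ∫ x, u' n x ∂ν = ∫ x, u n x ∂ν := fun n => integral_congr_ae (hac.ae_le (hu n))
  simpa only [e] using h ν hν hac

theorem const_mul (h : IsWeakStarLim μ l u v) (c : ℝ) :
    IsWeakStarLim μ l (fun n x => c * u n x) (fun x => c * v x) := by
  intro ν hν hac
  simpa only [integral_const_mul] using (h ν hν hac).const_mul c

theorem add (h : IsWeakStarLim μ l u v) (h' : IsWeakStarLim μ l u' v')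
    (hu : ∀ n, Measurable (u n)) (hu' : ∀ n, Measurable (u' n))
    (hv : Measurable v) (hv' : Measurable v') {C C' : ℝ}
    (hub : ∀ n, ∀ᵐ x ∂μ, |u n x| ≤ C) (hub' : ∀ n, ∀ᵐ x ∂μ, |u' n x| ≤ C')
    (hvb : ∀ᵐ x ∂μ, |v x| ≤ C) (hvb' : ∀ᵐ x ∂μ, |v' x| ≤ C') :
    IsWeakStarLim μ l (fun n x => u n x + u' n x) (fun x => v x + v' x) := by
  intro ν hν hac
  have e : ∀ n, ∫ x, (u n x + u' n x) ∂ν = ∫ x, u n x ∂ν + ∫ x, u' n x ∂ν := fun n =>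
    integral_add (integrable_of_abs_le (hu n) (hac.ae_le (hub n)))
      (integrable_of_abs_le (hu' n) (hac.ae_le (hub' n)))
  rw [integral_add (integrable_of_abs_le hv (hac.ae_le hvb))
    (integrable_of_abs_le hv' (hac.ae_le hvb'))]
  simp only [e]
  exact (h ν hν hac).add (h' ν hν hac)

/-- The multiplier is absorbed into the test measure. As `a` may change sign, `a + A ≥ 0` serves as
the density and `A` times the original limit is subtracted. -/
theorem mul_left (h : IsWeakStarLim μ l u v)
    (hu : ∀ n, Measurable (u n)) (hv : Measurable v) {C : ℝ}
    (hub : ∀ n, ∀ᵐ x ∂μ, |u n x| ≤ C) (hvb : ∀ᵐ x ∂μ, |v x| ≤ C)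
    {a : X → ℝ} {A : ℝ} (ha : Measurable a) (hab : ∀ᵐ x ∂μ, |a x| ≤ A) :
    IsWeakStarLim μ l (fun n x => a x * u n x) (fun x => a x * v x) := by
  intro ν hν hac
  let ν' := ν.withDensity fun x => ENNReal.ofReal (a x + A)
  have hν' : IsFiniteMeasure ν' := by
    refine isFiniteMeasure_withDensity_ofReal ?_
    exact ((integrable_of_abs_le ha (hac.ae_le hab)).add (integrable_const A)).2
  have e : ∀ f : X → ℝ, Measurable f → (∀ᵐ x ∂μ, |f x| ≤ C) →
      ∫ x, a x * f x ∂ν = ∫ x, f x ∂ν' - A * ∫ x, f x ∂ν := by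
    intro f hf hfb
    have hfi := integrable_of_abs_le hf (hac.ae_le hfb)
    have hai : Integrable (fun x => a x * f x) ν := by
      refine integrable_of_abs_le (C := A * C) (ha.mul hf) ?_
      filter_upwards [hac.ae_le hab, hac.ae_le hfb] with x h1 h2
      rw [abs_mul]
      exact mul_le_mul h1 h2 (abs_nonneg _) ((abs_nonneg _).trans h1)
    rw [integral_withDensity_eq_integral_toReal_smul (by fun_prop) (by simp),
      ← integral_const_mul, eq_sub_iff_add_eq, ← integral_add hai (hfi.const_mul A)]
    refine integral_congr_ae ?_
    filter_upwards [hac.ae_le hab] with x h1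
    rw [ENNReal.toReal_ofReal (by linarith [(abs_le.1 h1).1]), smul_eq_mul]
    ring
  rw [e v hv hvb]
  simp only [fun n => e (u n) (hu n) (hub n)]
  exact (h ν' hν' ((withDensity_absolutelyContinuous _ _).trans hac)).sub
    ((h ν hν hac).const_mul A)

theorem ae_eq [SFinite μ] [l.NeBot] (h : IsWeakStarLim μ l u v) (h' : IsWeakStarLim μ l u v')
    (hv : Measurable v) (hv' : Measurable v') {C C' : ℝ}
    (hvb : ∀ᵐ x ∂μ, |v x| ≤ C) (hvb' : ∀ᵐ x ∂μ, |v' x| ≤ C') : v =ᵐ[μ] v' := by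
  obtain ⟨ν₀, hfin, hμν, hνμ⟩ := exists_isFiniteMeasure_absolutelyContinuous μ
  refine hμν.ae_le (Integrable.ae_eq_of_forall_setIntegral_eq v v'
    (integrable_of_abs_le hv (hνμ.ae_le hvb)) (integrable_of_abs_le hv' (hνμ.ae_le hvb'))
    fun s _ _ => ?_)
  have hac : ν₀.restrict s ≪ μ := (Measure.absolutelyContinuous_of_le Measure.restrict_le_self).trans hνμ
  exact tendsto_nhds_unique (h _ inferInstance hac) (h' _ inferInstance hac)

theorem nonneg [SFinite μ] [l.NeBot] (h : IsWeakStarLim μ l u v) (hv : Measurable v) {C : ℝ}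
    (hvb : ∀ᵐ x ∂μ, |v x| ≤ C) (hu : ∀ n, ∀ᵐ x ∂μ, 0 ≤ u n x) : ∀ᵐ x ∂μ, 0 ≤ v x := by
  obtain ⟨ν₀, hfin, hμν, hνμ⟩ := exists_isFiniteMeasure_absolutelyContinuous μ
  refine hμν.ae_le (ae_nonneg_of_forall_setIntegral_nonneg
    (integrable_of_abs_le hv (hνμ.ae_le hvb)) fun s _ _ => ?_)
  have hac : ν₀.restrict s ≪ μ := (Measure.absolutelyContinuous_of_le Measure.restrict_le_self).trans hνμ
  exact ge_of_tendsto (h _ inferInstance hac)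
    (Eventually.of_forall fun n => integral_nonneg_of_ae (hac.ae_le (hu n)))

end IsWeakStarLim

/-- Integrals of a bounded function against measures that are close in total variation. -/
theorem abs_integral_sub_integral_le {Y : Type*} [MeasurableSpace Y] {ν ν' : Measure Y}
    [IsProbabilityMeasure ν] [IsProbabilityMeasure ν'] {ε : ℝ}
    (h : ∀ B, MeasurableSet B → |ν.real B - ν'.real B| ≤ ε) {f : Y → ℝ} (hf : Measurable f)
    {C : ℝ} (hC : 0 ≤ C) (hb : ∀ y, |f y| ≤ C) :
    |∫ y, f y ∂ν - ∫ y, f y ∂ν'| ≤ 2 * C * ε := by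
  -- Layer-cake formula for `f + C`, which takes values in `[0, 2C]`; the length of this interval is
  -- the factor in the bound.
  have lc : ∀ (τ : Measure Y) [IsProbabilityMeasure τ],
      ∫ y, f y ∂τ = (∫ t in Set.Ioc 0 (2 * C), τ.real {y | t ≤ f y + C}) - C := by
    intro τ _
    have hfi := integrable_of_abs_le (ν := τ) hf (Eventually.of_forall hb)
    rw [← Integrable.integral_eq_integral_Ioc_meas_le (f := fun y => f y + C)
      (hfi.add (integrable_const C)) (Eventually.of_forall fun y => by
        simpa using neg_le_iff_add_nonneg.1 (abs_le.1 (hb y)).1)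
      (Eventually.of_forall fun y => by
        have := (abs_le.1 (hb y)).2
        simp only; linarith), integral_add hfi (integrable_const C)]
    simp
  have hint : ∀ (τ : Measure Y) [IsProbabilityMeasure τ],
      IntegrableOn (fun t => τ.real {y | t ≤ f y + C}) (Set.Ioc 0 (2 * C)) := by
    intro τ _
    have hanti : Antitone fun t => τ.real {y | t ≤ f y + C} := fun s t hst =>
      measureReal_mono fun y (hy : t ≤ _) => hst.trans hy
    exact Integrable.of_bound hanti.measurable.aestronglyMeasurable 1
      (Eventually.of_forall fun t => by simp [abs_of_nonneg, measureReal_le_one])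
  rw [lc ν, lc ν', sub_sub_sub_cancel_right, ← integral_sub (hint ν) (hint ν')]
  have := norm_setIntegral_le_of_norm_le_const (μ := (volume : Measure ℝ))
    (s := Set.Ioc 0 (2 * C)) (C := ε)
    (f := fun t => ν.real {y | t ≤ f y + C} - ν'.real {y | t ≤ f y + C}) measure_Ioc_lt_top
    (fun t _ => h _ (measurableSet_le measurable_const (hf.add_const C)))
  simpa [hC, mul_comm, mul_assoc] using this

/-! ### Averages along a Reiter sequence and their convolution identity. -/

section GroupoidMean

variable {G : Type*} [Group G] [TopologicalSpace G] [IsTopologicalGroup G]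
  [LocallyCompactSpace G] [SecondCountableTopology G] [MeasurableSpace G] [BorelSpace G]
  {X : Type*} [MeasurableSpace X] {μ : Measure X}

/-- Absolute continuity of the `κ x` is what makes averages depend only on the class of `F` modulo
null sets. -/
theorem ae_kernel_of_ae_prod {κ : Kernel X G} (hκ : ∀ x, κ x ≪ (Measure.haar : Measure G))
    {p : X × G → Prop} (h : ∀ᵐ q ∂(μ.prod (Measure.haar : Measure G)), p q) :
    ∀ᵐ x ∂μ, ∀ᵐ g ∂(κ x), p (x, g) :=
  (Measure.ae_ae_of_ae_prod h).mono fun x hx => (hκ x).ae_le hx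

theorem measurable_integral_kernel {Y : Type*} [MeasurableSpace Y] (κ : Kernel X Y)
    [IsMarkovKernel κ] {F : X × Y → ℝ} (hF : Measurable F) :
    Measurable fun x => ∫ g, F (x, g) ∂(κ x) :=
  hF.stronglyMeasurable.integral_kernel_prod_right'.measurable

theorem ae_abs_integral_kernel_le {κ : Kernel X G} [IsMarkovKernel κ]
    (hκ : ∀ x, κ x ≪ (Measure.haar : Measure G)) {F : X × G → ℝ} {C : ℝ}
    (h : ∀ᵐ q ∂(μ.prod (Measure.haar : Measure G)), |F q| ≤ C) :
    ∀ᵐ x ∂μ, |∫ g, F (x, g) ∂(κ x)| ≤ C :=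
  (ae_kernel_of_ae_prod hκ h).mono fun x hx => by simpa using integral_le_mul_measureReal hx

/-- The total mass of the measure `k (x, h) dν(x) dh`. -/
theorem isFiniteMeasure_prod_withDensity {ν : Measure X} [IsFiniteMeasure ν] {k : X × G → ℝ≥0}
    (hk : Measurable k) {C : ℝ≥0}
    (hC : ∀ᵐ x ∂ν, ∫⁻ h, (k (x, h) : ℝ≥0∞) ∂(Measure.haar : Measure G) ≤ C) :
    IsFiniteMeasure ((ν.prod (Measure.haar : Measure G)).withDensity fun p => (k p : ℝ≥0∞)) := by
  refine isFiniteMeasure_withDensity (ne_of_lt ?_)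
  rw [lintegral_prod _ (by fun_prop)]
  refine (lintegral_mono_ae hC).trans_lt ?_
  simpa using ENNReal.mul_lt_top ENNReal.coe_lt_top (measure_lt_top ν _)

/-- Turns pairing with `k` into integration against one finite measure on `X × G`, to which
dominated convergence and weak* limits apply. -/
theorem integral_integral_mul_eq {ν : Measure X} [IsFiniteMeasure ν] {k : X × G → ℝ≥0}
    (hk : Measurable k) {C : ℝ≥0}
    (hC : ∀ᵐ x ∂ν, ∫⁻ h, (k (x, h) : ℝ≥0∞) ∂(Measure.haar : Measure G) ≤ C)
    {f : X × G → ℝ} (hf : Measurable f) {A : ℝ} (hA : ∀ p, |f p| ≤ A) :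
    ∫ x, ∫ h, f (x, h) * (k (x, h) : ℝ) ∂(Measure.haar : Measure G) ∂ν =
      ∫ p, f p ∂((ν.prod (Measure.haar : Measure G)).withDensity fun p => (k p : ℝ≥0∞)) := by
  have := isFiniteMeasure_prod_withDensity hk hC
  have hi : Integrable (fun p => f p * (k p : ℝ)) (ν.prod (Measure.haar : Measure G)) := by
    have h := (integrable_withDensity_iff_integrable_smul hk).1
      (integrable_of_abs_le (ν := (ν.prod (Measure.haar : Measure G)).withDensity
        fun p => (k p : ℝ≥0∞)) hf (Eventually.of_forall hA))
    simpa only [NNReal.smul_def, smul_eq_mul, mul_comm] using h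
  rw [integral_withDensity_eq_integral_smul hk, ← integral_prod _ hi]
  simp only [NNReal.smul_def, smul_eq_mul, mul_comm]

variable [SFinite μ] [MulAction G X] [MeasurableSMul₂ G X]

theorem quasiMeasurePreserving_inv_smul
    (hμ : ∀ g : G, Measure.QuasiMeasurePreserving (fun x : X => g • x) μ μ) :
    Measure.QuasiMeasurePreserving (fun p : X × G => p.2⁻¹ • p.1)
      (μ.prod (Measure.haar : Measure G)) μ :=
  QuasiMeasurePreserving.prod_of_left (by fun_prop) (Eventually.of_forall fun g => hμ g⁻¹)

theorem quasiMeasurePreserving_inv_smul_inv_mul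
    (hμ : ∀ g : G, Measure.QuasiMeasurePreserving (fun x : X => g • x) μ μ) :
    Measure.QuasiMeasurePreserving (fun q : (X × G) × G => (q.2⁻¹ • q.1.1, q.2⁻¹ * q.1.2))
      ((μ.prod (Measure.haar : Measure G)).prod (Measure.haar : Measure G))
      (μ.prod (Measure.haar : Measure G)) :=
  QuasiMeasurePreserving.prod_of_left (by fun_prop) (Eventually.of_forall fun g =>
    QuasiMeasurePreserving.prodMap (hμ g⁻¹)
      (measurePreserving_mul_left _ g⁻¹).quasiMeasurePreserving)

/-- Asymptotically invariant systems of probability measures on `G`, in the sense of Reiter. -/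
structure IsAsymptoticallyInvariant (μ : Measure X) (κ : ℕ → Kernel X G) : Prop where
  markov : ∀ n, IsMarkovKernel (κ n)
  absolutelyContinuous : ∀ n x, κ n x ≪ (Measure.haar : Measure G)
  invariant : ∀ g : G, ∀ᵐ x ∂μ, ∀ ε : ℝ, 0 < ε → ∀ᶠ n in atTop, ∀ B, MeasurableSet B →
    |((κ n x).map (fun h => g * h)).real B - (κ n (g • x)).real B| ≤ ε

namespace IsAsymptoticallyInvariant

variable {κ : ℕ → Kernel X G}

/-- The null set in the Reiter condition depends on the group element. Fubini, applied to the
measurable set of convergence, trades "for every `h`, almost every `x`" for "almost every `(x, h)`".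
-/
theorem ae_tendsto_sub (hκ : IsAsymptoticallyInvariant μ κ) {F : X × G → ℝ} (hF : Measurable F)
    {C : ℝ} (hC : 0 ≤ C) (hFb : ∀ p, |F p| ≤ C) :
    ∀ᵐ p ∂(μ.prod (Measure.haar : Measure G)),
      Tendsto (fun n => ∫ g, F (p.2⁻¹ • p.1, p.2⁻¹ * g) ∂(κ n p.1) -
        ∫ g, F (p.2⁻¹ • p.1, g) ∂(κ n (p.2⁻¹ • p.1))) atTop (𝓝 0) := by
  have := hκ.markov
  have hm : MeasurableSet {p : X × G | Tendsto
      (fun n => ∫ g, F (p.2⁻¹ • p.1, p.2⁻¹ * g) ∂(κ n p.1) -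
        ∫ g, F (p.2⁻¹ • p.1, g) ∂(κ n (p.2⁻¹ • p.1))) atTop (𝓝 0)} := by
    refine measurableSet_tendsto _ fun n => ?_
    refine Measurable.sub ?_ ?_
    · exact measurable_integral_kernel ((κ n).comap Prod.fst measurable_fst)
        (F := fun q : (X × G) × G => F (q.1.2⁻¹ • q.1.1, q.1.2⁻¹ * q.2)) (by fun_prop)
    · exact (measurable_integral_kernel (κ n) hF).comp (by fun_prop)
  rw [Measure.ae_prod_iff_ae_ae hm]
  rw [Measure.ae_ae_comm (p := fun x h => Tendsto
      (fun n => ∫ g, F (h⁻¹ • x, h⁻¹ * g) ∂(κ n x) -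
        ∫ g, F (h⁻¹ • x, g) ∂(κ n (h⁻¹ • x))) atTop (𝓝 0)) hm]
  refine Eventually.of_forall fun h => ?_
  filter_upwards [hκ.invariant h⁻¹] with x hx
  rw [Metric.tendsto_nhds]
  intro ε hε
  -- Integrals of `F` move by at most `2 * C` times the total variation bound; the extra `1` keeps
  -- the denominator positive and the final inequality strict.
  filter_upwards [hx (ε / (2 * C + 1)) (by positivity)] with n hn
  rw [Real.dist_eq, sub_zero]
  have hmul : Measurable fun g : G => h⁻¹ * g := measurable_const_mul h⁻¹
  have : IsProbabilityMeasure ((κ n x).map fun g => h⁻¹ * g) :=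
    Measure.isProbabilityMeasure_map hmul.aemeasurable
  have hle := abs_integral_sub_integral_le hn (f := fun g => F (h⁻¹ • x, g)) (by fun_prop) hC
    fun g => hFb _
  rw [integral_map hmul.aemeasurable (Measurable.aestronglyMeasurable (by fun_prop))] at hle
  refine hle.trans_lt ?_
  rw [← mul_div_assoc, div_lt_iff₀ (by positivity)]
  nlinarith

/-- The weak* limits of the averages of `F` and of `k * F`. -/
theorem isWeakStarLim_conv (hκ : IsAsymptoticallyInvariant μ κ)
    (hμ : ∀ g : G, Measure.QuasiMeasurePreserving (fun x : X => g • x) μ μ)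
    {l : Filter ℕ} (hl : l ≤ atTop) {F F' : X × G → ℝ} (hF : Measurable F)
    {C : ℝ} (hC : 0 ≤ C) (hFb : ∀ p, |F p| ≤ C)
    {k : X × G → ℝ≥0} (hk : Measurable k) {K : ℝ≥0}
    (hK : ∀ᵐ x ∂μ, ∫⁻ h, (k (x, h) : ℝ≥0∞) ∂(Measure.haar : Measure G) ≤ K)
    (hF' : ∀ᵐ p ∂(μ.prod (Measure.haar : Measure G)),
      F' p = ∫ h, F (h⁻¹ • p.1, h⁻¹ * p.2) * (k (p.1, h) : ℝ) ∂(Measure.haar : Measure G))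
    {v : X → ℝ} (hv : Measurable v) (hvb : ∀ x, |v x| ≤ C)
    (hlim : IsWeakStarLim μ l (fun n x => ∫ g, F (x, g) ∂(κ n x)) v) :
    IsWeakStarLim μ l (fun n x => ∫ g, F' (x, g) ∂(κ n x))
      (fun x => ∫ h, v (h⁻¹ • x) * (k (x, h) : ℝ) ∂(Measure.haar : Measure G)) := by
  have := hκ.markov
  intro ν hν hac
  have hKν := hac.ae_le hK
  let ρ := (ν.prod (Measure.haar : Measure G)).withDensity fun p => (k p : ℝ≥0∞)
  have hρ : IsFiniteMeasure ρ := isFiniteMeasure_prod_withDensity hk hKν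
  have hρac : ρ ≪ μ.prod (Measure.haar : Measure G) :=
    (withDensity_absolutelyContinuous _ _).trans (hac.prod .rfl)
  -- `a n` averages the translate of `F` over `κ n x`; `b n` averages `F` itself over the fibre at
  -- `h⁻¹ • x`. Asymptotic invariance makes them interchangeable.
  let a : ℕ → X × G → ℝ := fun n p => ∫ g, F (p.2⁻¹ • p.1, p.2⁻¹ * g) ∂(κ n p.1)
  let b : ℕ → X × G → ℝ := fun n p => ∫ g, F (p.2⁻¹ • p.1, g) ∂(κ n (p.2⁻¹ • p.1))
  have ham : ∀ n, Measurable (a n) := fun n =>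
    measurable_integral_kernel ((κ n).comap Prod.fst measurable_fst)
      (F := fun q : (X × G) × G => F (q.1.2⁻¹ • q.1.1, q.1.2⁻¹ * q.2)) (by fun_prop)
  have hbm : ∀ n, Measurable (b n) := fun n =>
    (measurable_integral_kernel (κ n) hF).comp (by fun_prop)
  have hab : ∀ n p, |a n p| ≤ C := fun n p => by
    simpa using integral_le_mul_measureReal (ν := κ n p.1)
      (Eventually.of_forall fun g => hFb (p.2⁻¹ • p.1, p.2⁻¹ * g))
  have hbb : ∀ n p, |b n p| ≤ C := fun n p => by
    simpa using integral_le_mul_measureReal (ν := κ n (p.2⁻¹ • p.1))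
      (Eventually.of_forall fun g => hFb (p.2⁻¹ • p.1, g))
  have ha : ∀ n, ∫ x, ∫ g, F' (x, g) ∂(κ n x) ∂ν = ∫ p, a n p ∂ρ := by
    intro n
    rw [← integral_integral_mul_eq hk hKν (ham n) (hab n)]
    refine integral_congr_ae ?_
    filter_upwards [hac.ae_le (ae_kernel_of_ae_prod (hκ.absolutelyContinuous n) hF'), hKν]
      with x hx hkx
    rw [integral_congr_ae hx]
    rw [integral_integral_swap]
    · simp only [integral_mul_const, a]
    · have hki : Integrable (fun q : G × G => (k (x, q.2) : ℝ))
          ((κ n x).prod (Measure.haar : Measure G)) := by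
        refine Integrable.comp_snd (f := fun h => (k (x, h) : ℝ)) ?_ _
        refine ⟨(hk.comp measurable_prodMk_left).coe_nnreal_real.aestronglyMeasurable, ?_⟩
        simpa [HasFiniteIntegral] using hkx.trans_lt ENNReal.coe_lt_top
      refine hki.bdd_mul (c := C) (f := fun q : G × G => F (q.2⁻¹ • x, q.2⁻¹ * q.1)) ?_
        (Eventually.of_forall fun q => hFb _)
      exact Measurable.aestronglyMeasurable (by fun_prop)
  have hD : Tendsto (fun n => ∫ p, (a n p - b n p) ∂ρ) l (𝓝 0) := by
    have h := tendsto_integral_of_dominated_convergence (μ := ρ)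
      (F := fun n p => a n p - b n p) (f := fun _ => 0) (fun _ => 2 * C)
      (fun n => ((ham n).sub (hbm n)).aestronglyMeasurable) (integrable_const _)
      (fun n => Eventually.of_forall fun p => by
        have h1 := abs_sub (a n p) (b n p)
        have h2 := hab n p
        have h3 := hbb n p
        rw [Real.norm_eq_abs]; linarith)
      (hρac.ae_le (hκ.ae_tendsto_sub hF hC hFb))
    simpa using h.mono_left hl
  have hmap : Measurable fun p : X × G => p.2⁻¹ • p.1 := by fun_prop
  have hb : Tendsto (fun n => ∫ p, b n p ∂ρ) l
      (𝓝 (∫ x, ∫ h, v (h⁻¹ • x) * (k (x, h) : ℝ) ∂(Measure.haar : Measure G) ∂ν)) := by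
    rw [integral_integral_mul_eq hk hKν (f := fun p => v (p.2⁻¹ • p.1)) (hv.comp hmap)
      fun p => hvb _]
    -- `b n` is the `n`-th average of `F` composed with `(x, h) ↦ h⁻¹ • x`, so the hypothesis is
    -- tested on the image of `ρ`, which is absolutely continuous because the action is nonsingular.
    have hτ : ρ.map (fun p : X × G => p.2⁻¹ • p.1) ≪ μ :=
      (hρac.map hmap).trans (quasiMeasurePreserving_inv_smul hμ).absolutelyContinuous
    have h := hlim _ (Measure.isFiniteMeasure_map ρ _) hτ
    rw [integral_map hmap.aemeasurable hv.aestronglyMeasurable] at h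
    refine h.congr fun n => ?_
    rw [integral_map hmap.aemeasurable
      (measurable_integral_kernel (κ n) hF).aestronglyMeasurable]
  have := hD.add hb
  rw [zero_add] at this
  refine this.congr fun n => ?_
  rw [ha n, integral_sub (integrable_of_abs_le (ham n) (Eventually.of_forall (hab n)))
    (integrable_of_abs_le (hbm n) (Eventually.of_forall (hbb n)))]
  ring

end IsAsymptoticallyInvariant

end GroupoidMean

/-! ### The invariant mean as a weak* ultralimit. -/

section GroupoidMean

variable {G : Type*} [Group G] [TopologicalSpace G] [IsTopologicalGroup G]
  [LocallyCompactSpace G] [SecondCountableTopology G] [MeasurableSpace G] [BorelSpace G]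
  {X : Type*} [MeasurableSpace X] {μ : Measure X} [SFinite μ] [MulAction G X]
  [MeasurableSMul₂ G X]

theorem ae_abs_le_norm_linfty {Y : Type*} [MeasurableSpace Y] {τ : Measure Y} (F : Lp ℝ ∞ τ) :
    ∀ᵐ y ∂τ, |F y| ≤ ‖F‖ := by
  have h := ae_le_eLpNormEssSup (f := F) (μ := τ)
  filter_upwards [h] with y hy
  rw [Lp.norm_def, eLpNorm_exponent_top, ← Real.norm_eq_abs, ← toReal_enorm]
  refine ENNReal.toReal_mono ?_ hy
  simpa using Lp.eLpNorm_ne_top F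

/-- A Reiter sequence yields an invariant mean. -/
theorem IsAsymptoticallyInvariant.isAmenableAction {κ : ℕ → Kernel X G}
    (hκ : IsAsymptoticallyInvariant μ κ)
    (hμ : ∀ g : G, Measure.QuasiMeasurePreserving (fun x : X => g • x) μ μ) :
    IsAmenableAction G μ := by
  have := hκ.markov
  let U : Ultrafilter ℕ := Ultrafilter.of atTop
  have hU : (U : Filter ℕ) ≤ atTop := Ultrafilter.of_le _
  let η : Measure (X × G) := μ.prod (Measure.haar : Measure G)
  let avg : (X × G → ℝ) → ℕ → X → ℝ := fun F n x => ∫ g, F (x, g) ∂(κ n x)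
  have havgm : ∀ F : Lp ℝ ∞ η, ∀ n, Measurable (avg F n) := fun F n =>
    measurable_integral_kernel (κ n) (Lp.stronglyMeasurable F).measurable
  have havgb : ∀ F : Lp ℝ ∞ η, ∀ n, ∀ᵐ x ∂μ, |avg F n x| ≤ ‖F‖ := fun F n =>
    ae_abs_integral_kernel_le (hκ.absolutelyContinuous n) (ae_abs_le_norm_linfty F)
  have havgi : ∀ F : Lp ℝ ∞ η, ∀ n, ∀ᵐ x ∂μ, Integrable (fun g => F (x, g)) (κ n x) :=
    fun F n => (ae_kernel_of_ae_prod (hκ.absolutelyContinuous n)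
      (ae_abs_le_norm_linfty F)).mono fun x hx => integrable_of_abs_le
        ((Lp.stronglyMeasurable F).measurable.comp measurable_prodMk_left) hx
  have havgc : ∀ F F' : X × G → ℝ, (∀ᵐ p ∂η, F p = F' p) → ∀ n, ∀ᵐ x ∂μ,
      avg F n x = avg F' n x := fun F F' h n =>
    (ae_kernel_of_ae_prod (hκ.absolutelyContinuous n) h).mono fun x hx => integral_congr_ae hx
  -- The limits are chosen separately for each `F`; uniqueness of weak* limits modulo `μ` makes the
  -- choice linear.
  choose v hvm hvb hvl' using fun F : Lp ℝ ∞ η => exists_weakStar_ultralimit μ U ‖F‖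
    (norm_nonneg F) (avg F) (havgm F) (havgb F)
  have hvl : ∀ F : Lp ℝ ∞ η, IsWeakStarLim μ U (avg F) (v F) := hvl'
  have hvba : ∀ F : Lp ℝ ∞ η, ∀ᵐ x ∂μ, |v F x| ≤ ‖F‖ := fun F => Eventually.of_forall (hvb F)
  have hvLp : ∀ F : Lp ℝ ∞ η, MemLp (v F) ∞ μ := fun F =>
    memLp_top_of_bound (hvm F).aestronglyMeasurable ‖F‖ (hvba F)
  let M : Lp ℝ ∞ η →ₗ[ℝ] Lp ℝ ∞ μ :=
    { toFun := fun F => (hvLp F).toLp (v F)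
      map_add' := fun F F' => by
        rw [← MemLp.toLp_add, MemLp.toLp_eq_toLp_iff]
        refine (hvl (F + F')).ae_eq (C' := ‖F‖ + ‖F'‖) (IsWeakStarLim.congr
          ((hvl F).add (hvl F') (havgm F) (havgm F') (hvm F) (hvm F') (havgb F) (havgb F')
            (hvba F) (hvba F')) fun n => ?_) (hvm _) ((hvm F).add (hvm F')) (hvba _)
          (Eventually.of_forall fun x => (abs_add_le _ _).trans (add_le_add (hvb F x) (hvb F' x)))
        filter_upwards [havgc _ _ (Lp.coeFn_add F F') n, havgi F n, havgi F' n] with x hx h1 h2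
        rw [hx]
        exact integral_add h1 h2
      map_smul' := fun c F => by
        rw [RingHom.id_apply, ← MemLp.toLp_const_smul, MemLp.toLp_eq_toLp_iff]
        refine (hvl (c • F)).ae_eq (C' := |c| * ‖F‖) (IsWeakStarLim.congr
          ((hvl F).const_mul c) fun n => ?_) (hvm _) ((hvm F).const_mul c) (hvba _)
          (Eventually.of_forall fun x => (abs_mul c (v F x)).trans_le
            (mul_le_mul_of_nonneg_left (hvb F x) (abs_nonneg c)))
        filter_upwards [havgc _ _ (Lp.coeFn_smul c F) n] with x hx
        rw [hx]
        exact integral_const_mul c _ }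
  have hM : ∀ F : Lp ℝ ∞ η, M F =ᵐ[μ] v F := fun F => (hvLp F).coeFn_toLp
  refine ⟨M, fun F hF => ?_, fun F hF => ?_, fun a F F' h => ?_, fun k hk ⟨K, hK⟩ F F' h => ?_⟩
  · have h0 := (hvl F).nonneg (hvm F) (hvba F) fun n =>
      (ae_kernel_of_ae_prod (hκ.absolutelyContinuous n) hF).mono fun x hx =>
        integral_nonneg_of_ae hx
    filter_upwards [hM F, h0] with x h1 h2
    rwa [h1]
  · have h1 : IsWeakStarLim μ U (avg F) fun _ => 1 := by
      refine IsWeakStarLim.congr (u := fun _ _ => 1) (fun ν _ _ => tendsto_const_nhds)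
        fun n => ?_
      filter_upwards [havgc F (fun _ => 1) hF n] with x hx
      rw [hx]
      simp [avg]
    exact (hM F).trans ((hvl F).ae_eq h1 (hvm F) measurable_const (hvba F)
      (C' := 1) (Eventually.of_forall fun x => by simp))
  · have ham := (Lp.stronglyMeasurable a).measurable
    have h1 : IsWeakStarLim μ U (avg F') fun x => a x * v F x := by
      refine IsWeakStarLim.congr ((hvl F).mul_left (havgm F) (hvm F) (havgb F) (hvba F) ham
        (ae_abs_le_norm_linfty a)) fun n => ?_
      filter_upwards [havgc F' (fun p => a p.1 * F p) h n] with x hx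
      rw [hx]
      exact integral_const_mul (a x) _
    have h2 := (hvl F').ae_eq h1 (hvm F') (ham.mul (hvm F)) (hvba F') (C' := ‖a‖ * ‖F‖) (by
      filter_upwards [ae_abs_le_norm_linfty a] with x hx
      rw [abs_mul]
      exact mul_le_mul hx (hvb F x) (abs_nonneg _) (norm_nonneg _))
    filter_upwards [h2, hM F, hM F'] with x h3 h4 h5
    rw [h5, h4, h3]
  -- `isWeakStarLim_conv` needs a bound at every point. The replacement is invisible to the
  -- convolution, since translation in the groupoid preserves null sets.
  · let F₀ : X × G → ℝ := fun p => max (-‖F‖) (min ‖F‖ (F p))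
    have hF₀m : Measurable F₀ := measurable_const.max
      (measurable_const.min (Lp.stronglyMeasurable F).measurable)
    have hF₀b : ∀ p, |F₀ p| ≤ ‖F‖ := fun p => abs_le.2
      ⟨le_max_left _ _, max_le (by linarith [norm_nonneg F]) (min_le_left _ _)⟩
    have hF₀ : ∀ᵐ p ∂η, F p = F₀ p := by
      filter_upwards [ae_abs_le_norm_linfty F] with p hp
      simp [F₀, (abs_le.1 hp).1, (abs_le.1 hp).2]
    have hF' : ∀ᵐ p ∂η, F' p = ∫ h, F₀ (h⁻¹ • p.1, h⁻¹ * p.2) * (k (p.1, h) : ℝ)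
        ∂(Measure.haar : Measure G) := by
      filter_upwards [h, Measure.ae_ae_of_ae_prod
        ((quasiMeasurePreserving_inv_smul_inv_mul hμ).ae hF₀)] with p h1 h2
      rw [h1]
      refine integral_congr_ae ?_
      filter_upwards [h2] with g hg
      rw [hg]
    have h1 := hκ.isWeakStarLim_conv hμ hU hF₀m (norm_nonneg F) hF₀b hk hK hF' (hvm F) (hvb F)
      ((hvl F).congr fun n => havgc _ _ (hF₀.mono fun p hp => hp.symm) n)
    have hvm' : Measurable fun x => ∫ h, v F (h⁻¹ • x) * (k (x, h) : ℝ)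
        ∂(Measure.haar : Measure G) := by
      refine (StronglyMeasurable.integral_prod_right' (f := fun p : X × G =>
        v F (p.2⁻¹ • p.1) * (k p : ℝ)) (Measurable.stronglyMeasurable ?_)).measurable
      exact ((hvm F).comp (by fun_prop)).mul hk.coe_nnreal_real
    have h2 := (hvl F').ae_eq h1 (hvm F') hvm' (hvba F') (C' := ‖F‖ * K) (by
      filter_upwards [hK] with x hx
      have hkx : Integrable (fun h => (k (x, h) : ℝ)) (Measure.haar : Measure G) :=
        ⟨(hk.comp measurable_prodMk_left).coe_nnreal_real.aestronglyMeasurable, by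
          simpa [HasFiniteIntegral] using hx.trans_lt ENNReal.coe_lt_top⟩
      rw [← Real.norm_eq_abs]
      refine (norm_integral_le_of_norm_le (hkx.const_mul ‖F‖) (Eventually.of_forall fun h => ?_)).trans
        ?_
      · rw [norm_mul, Real.norm_of_nonneg (k (x, h)).coe_nonneg]
        exact mul_le_mul_of_nonneg_right (hvb F _) (k (x, h)).coe_nonneg
      · rw [integral_const_mul]
        refine mul_le_mul_of_nonneg_left ?_ (norm_nonneg F)
        rw [integral_eq_lintegral_of_nonneg_ae (Eventually.of_forall fun h => NNReal.coe_nonneg _)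
          hkx.1]
        exact ENNReal.toReal_le_of_le_ofReal K.coe_nonneg (by simpa using hx))
    filter_upwards [h2, hM F', Measure.ae_ae_of_ae_prod
      ((quasiMeasurePreserving_inv_smul hμ).ae (hM F))] with x h3 h4 h5
    rw [h4, h3]
    refine integral_congr_ae ?_
    filter_upwards [h5] with g hg
    rw [hg]

end GroupoidMean

/-! ### Finite potentials and Cesàro averages of Doob transforms. -/

section Liouville

variable {S : Type*} [MeasurableSpace S] {m : Measure S} {P : Kernel S S}

/-- The sum `θ + θ P + ⋯ + θ P ^ (n - 1)`. -/
noncomputable def truncatedPotential (P : Kernel S S) (θ : Measure S) : ℕ → Measure S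
  | 0 => 0
  | n + 1 => θ + (truncatedPotential P θ n).bind P

/-- The sum `f + P f + ⋯ + P ^ (n - 1) f`. -/
noncomputable def truncatedPotentialFun (P : Kernel S S) : ℕ → (S → ℝ≥0∞) → S → ℝ≥0∞
  | 0, _ => 0
  | n + 1, f => fun s => f s + truncatedPotentialFun P n (fun t => ∫⁻ r, f r ∂(P t)) s

/-- The function `P ^ n f`. -/
noncomputable def iterateMarkov (P : Kernel S S) : ℕ → (S → ℝ≥0∞) → S → ℝ≥0∞
  | 0, f => f
  | n + 1, f => iterateMarkov P n fun t => ∫⁻ r, f r ∂(P t)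

theorem measurable_truncatedPotentialFun (n : ℕ) {f : S → ℝ≥0∞} (hf : Measurable f) :
    Measurable (truncatedPotentialFun P n f) := by
  induction n generalizing f with
  | zero => exact measurable_zero
  | succ n ih => exact hf.add (ih hf.lintegral_kernel)

theorem measurable_iterateMarkov (n : ℕ) {f : S → ℝ≥0∞} (hf : Measurable f) :
    Measurable (iterateMarkov P n f) := by
  induction n generalizing f with
  | zero => exact hf
  | succ n ih => exact ih hf.lintegral_kernel

theorem lintegral_truncatedPotential (θ : Measure S) (n : ℕ) {f : S → ℝ≥0∞} (hf : Measurable f) :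
    ∫⁻ s, f s ∂(truncatedPotential P θ n) = ∫⁻ s, truncatedPotentialFun P n f s ∂θ := by
  induction n generalizing f with
  | zero => simp [truncatedPotential, truncatedPotentialFun]
  | succ n ih =>
    rw [truncatedPotential, lintegral_add_measure,
      Measure.lintegral_bind P.measurable.aemeasurable hf.aemeasurable, ih hf.lintegral_kernel]
    simp only [truncatedPotentialFun]
    rw [lintegral_add_left hf]

/-- The telescoping identity `P H - H = P ^ n f - f` for the potential `H`, written without
subtraction in `ℝ≥0∞`. After division by `n` the right side will vanish in the limit. -/
theorem lintegral_truncatedPotentialFun_add (n : ℕ) {f : S → ℝ≥0∞} (hf : Measurable f) (s : S) :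
    ∫⁻ t, truncatedPotentialFun P n f t ∂(P s) + f s =
      truncatedPotentialFun P n f s + iterateMarkov P n f s := by
  induction n generalizing f with
  | zero => simp [truncatedPotentialFun, iterateMarkov]
  | succ n ih =>
    simp only [truncatedPotentialFun, iterateMarkov]
    rw [lintegral_add_left hf, add_assoc (f s), ← ih hf.lintegral_kernel]
    ring

theorem bind_absolutelyContinuous (hP : m.bind P ≪ m) {θ : Measure S} (hθ : θ ≪ m) :
    θ.bind P ≪ m := by
  refine Measure.AbsolutelyContinuous.trans (Measure.AbsolutelyContinuous.mk fun A hA h0 => ?_) hP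
  rw [Measure.bind_apply hA P.measurable.aemeasurable] at h0 ⊢
  rw [lintegral_eq_zero_iff (P.measurable_coe hA)] at h0 ⊢
  exact hθ.ae_le h0

theorem truncatedPotential_absolutelyContinuous (hP : m.bind P ≪ m) {θ : Measure S} (hθ : θ ≪ m)
    (n : ℕ) : truncatedPotential P θ n ≪ m := by
  induction n with
  | zero => exact Measure.AbsolutelyContinuous.zero m
  | succ n ih => exact hθ.add_left (bind_absolutelyContinuous hP ih)

theorem ae_ae_of_bind_absolutelyContinuous (hP : m.bind P ≪ m) {p : S → Prop}
    (h : ∀ᵐ s ∂m, p s) : ∀ᵐ s ∂m, ∀ᵐ t ∂(P s), p t :=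
  Measure.ae_ae_of_ae_bind P.measurable.aemeasurable (hP.ae_le h)

theorem ae_lintegral_le (hP : m.bind P ≪ m) {f φ : S → ℝ≥0∞}
    (hφ : ∀ᵐ s ∂m, ∫⁻ t, φ t ∂(P s) = φ s) (h : ∀ᵐ s ∂m, f s ≤ φ s) :
    ∀ᵐ s ∂m, ∫⁻ t, f t ∂(P s) ≤ φ s := by
  filter_upwards [hφ, ae_ae_of_bind_absolutelyContinuous hP h] with s h1 h2
  exact (lintegral_mono_ae h2).trans h1.le

theorem ae_iterateMarkov_le (hP : m.bind P ≪ m) {f φ : S → ℝ≥0∞}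
    (hφ : ∀ᵐ s ∂m, ∫⁻ t, φ t ∂(P s) = φ s) (h : ∀ᵐ s ∂m, f s ≤ φ s) (n : ℕ) :
    ∀ᵐ s ∂m, iterateMarkov P n f s ≤ φ s := by
  induction n generalizing f with
  | zero => exact h
  | succ n ih => exact ih (ae_lintegral_le hP hφ h)

theorem ae_truncatedPotentialFun_le (hP : m.bind P ≪ m) {f φ : S → ℝ≥0∞}
    (hφ : ∀ᵐ s ∂m, ∫⁻ t, φ t ∂(P s) = φ s) (h : ∀ᵐ s ∂m, f s ≤ φ s) (n : ℕ) :
    ∀ᵐ s ∂m, truncatedPotentialFun P n f s ≤ n * φ s := by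
  induction n generalizing f with
  | zero => simp [truncatedPotentialFun]
  | succ n ih =>
    filter_upwards [h, ih (ae_lintegral_le hP hφ h)] with s h1 h2
    simp only [truncatedPotentialFun, Nat.cast_add, Nat.cast_one]
    rw [add_mul, one_mul, add_comm]
    exact add_le_add h2 h1

/-- Conservation of `φ`-mass: this is the Markov property of the Doob transform, expressed without
dividing by `φ`. -/
theorem lintegral_bind_of_harmonic {θ : Measure S} (hθ : θ ≪ m) {φ : S → ℝ≥0∞}
    (hφm : Measurable φ) (hφ : ∀ᵐ s ∂m, ∫⁻ t, φ t ∂(P s) = φ s) :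
    ∫⁻ s, φ s ∂(θ.bind P) = ∫⁻ s, φ s ∂θ := by
  rw [Measure.lintegral_bind P.measurable.aemeasurable hφm.aemeasurable]
  exact lintegral_congr_ae (hθ.ae_le hφ)

theorem lintegral_truncatedPotential_of_harmonic (hP : m.bind P ≪ m) {θ : Measure S} (hθ : θ ≪ m)
    {φ : S → ℝ≥0∞} (hφm : Measurable φ) (hφ : ∀ᵐ s ∂m, ∫⁻ t, φ t ∂(P s) = φ s) (n : ℕ) :
    ∫⁻ s, φ s ∂(truncatedPotential P θ n) = n * ∫⁻ s, φ s ∂θ := by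
  induction n with
  | zero => simp [truncatedPotential]
  | succ n ih =>
    rw [truncatedPotential, lintegral_add_measure, lintegral_bind_of_harmonic
      (truncatedPotential_absolutelyContinuous hP hθ n) hφm hφ, ih]
    push_cast
    ring

/-- The Cesàro averages of the `n`-step distributions of the Doob transform of `P` by a harmonic
function `φ`, with initial distribution `φ θ`. -/
noncomputable def doobCesaro (P : Kernel S S) (φ : S → ℝ≥0) (θ : Measure S) (n : ℕ) : Measure S :=
  (n : ℝ≥0∞)⁻¹ • (truncatedPotential P θ n).withDensity fun s => (φ s : ℝ≥0∞)

theorem doobCesaro_absolutelyContinuous (hP : m.bind P ≪ m) (φ : S → ℝ≥0) {θ : Measure S}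
    (hθ : θ ≪ m) (n : ℕ) : doobCesaro P φ θ n ≪ m :=
  ((withDensity_absolutelyContinuous _ _).smul_left _).trans
    (truncatedPotential_absolutelyContinuous hP hθ n)

theorem doobCesaro_apply (φ : S → ℝ≥0) (hφ : Measurable φ) (θ : Measure S) (n : ℕ) {A : Set S}
    (hA : MeasurableSet A) : doobCesaro P φ θ n A =
      (n : ℝ≥0∞)⁻¹ * ∫⁻ s, truncatedPotentialFun P n (A.indicator fun s => (φ s : ℝ≥0∞)) s ∂θ := by
  rw [← lintegral_truncatedPotential _ _ (hφ.coe_nnreal_ennreal.indicator hA), doobCesaro,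
    Measure.smul_apply, withDensity_apply _ hA, lintegral_indicator hA, smul_eq_mul]

theorem doobCesaro_univ (hP : m.bind P ≪ m) {φ : S → ℝ≥0} (hφ : IsHarmonic m P φ) {θ : Measure S}
    (hθ : θ ≪ m) (h1 : ∫⁻ s, (φ s : ℝ≥0∞) ∂θ = 1) {n : ℕ} (hn : n ≠ 0) :
    doobCesaro P φ θ n Set.univ = 1 := by
  rw [doobCesaro, Measure.smul_apply, withDensity_apply _ MeasurableSet.univ,
    Measure.restrict_univ, lintegral_truncatedPotential_of_harmonic hP hθ
      hφ.1.coe_nnreal_ennreal hφ.2, h1, mul_one, smul_eq_mul]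
  exact ENNReal.inv_mul_cancel (by simpa using hn) (ENNReal.natCast_ne_top n)

theorem exists_weakStar_ultralimit_ennreal (m : Measure S) [SFinite m] (U : Ultrafilter ℕ)
    (u : ℕ → S → ℝ≥0∞) (hu : ∀ n, Measurable (u n)) (hb : ∀ n s, u n s ≤ 1) :
    ∃ v : S → ℝ≥0, Measurable v ∧ (∀ s, v s ≤ 1) ∧ ∀ ν : Measure S, IsFiniteMeasure ν → ν ≪ m →
      Tendsto (fun n => ∫⁻ s, u n s ∂ν) U (𝓝 (∫⁻ s, (v s : ℝ≥0∞) ∂ν)) := by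
  have hb' : ∀ n s, |(u n s).toReal| ≤ 1 := fun n s => by
    rw [ENNReal.abs_toReal]
    exact ENNReal.toReal_le_of_le_ofReal zero_le_one (by simpa using hb n s)
  obtain ⟨w, hw, hwb, hlim⟩ := exists_weakStar_ultralimit m U 1 zero_le_one
    (fun n s => (u n s).toReal) (fun n => (hu n).ennreal_toReal)
    (fun n => Eventually.of_forall (hb' n))
  have h0 : ∀ᵐ s ∂m, 0 ≤ w s := IsWeakStarLim.nonneg (u := fun n s => (u n s).toReal) hlim hw
    (Eventually.of_forall hwb) fun n => Eventually.of_forall fun s => ENNReal.toReal_nonneg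
  refine ⟨fun s => (w s).toNNReal, hw.real_toNNReal,
    fun s => Real.toNNReal_le_one.2 (abs_le.1 (hwb s)).2, fun ν hν hac => ?_⟩
  have e1 : ∀ n, ∫⁻ s, u n s ∂ν = ENNReal.ofReal (∫ s, (u n s).toReal ∂ν) := fun n => by
    rw [ofReal_integral_eq_lintegral_ofReal
      (integrable_of_abs_le (hu n).ennreal_toReal (Eventually.of_forall (hb' n)))
      (Eventually.of_forall fun s => ENNReal.toReal_nonneg)]
    exact lintegral_congr fun s => (ENNReal.ofReal_toReal
      ((hb n s).trans_lt ENNReal.one_lt_top).ne).symm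
  have e2 : ∫⁻ s, ((w s).toNNReal : ℝ≥0∞) ∂ν = ENNReal.ofReal (∫ s, w s ∂ν) := by
    rw [ofReal_integral_eq_lintegral_ofReal
      (integrable_of_abs_le hw (Eventually.of_forall hwb)) (hac.ae_le h0)]
    rfl
  rw [e2]
  simp only [e1]
  exact (ENNReal.continuous_ofReal.tendsto _).comp (hlim ν hν hac)

/-- A finite measure equivalent to `m` that integrates `φ`. -/
theorem exists_equivalent_measure_lintegral_ne_top (m : Measure S) [SFinite m] {φ : S → ℝ≥0}
    (hφ : Measurable φ) : ∃ θ : Measure S, IsFiniteMeasure θ ∧ m ≪ θ ∧ θ ≪ m ∧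
      ∫⁻ s, (φ s : ℝ≥0∞) ∂θ ≠ ∞ := by
  obtain ⟨ν, hν, h1, h2⟩ := exists_isFiniteMeasure_absolutelyContinuous m
  -- The weight `(1 + φ)⁻¹` is positive, and both it and its product with `φ` are at most `1`.
  have hm : Measurable fun s => ((1 + φ s)⁻¹ : ℝ≥0) := by fun_prop
  refine ⟨ν.withDensity fun s => ((1 + φ s)⁻¹ : ℝ≥0), ?_, h1.trans ?_,
    (withDensity_absolutelyContinuous _ _).trans h2, ?_⟩
  · refine isFiniteMeasure_withDensity (ne_of_lt ?_)
    refine (lintegral_mono (g := fun _ => 1) fun s => ?_).trans_lt (by simp)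
    have : (1 + φ s)⁻¹ ≤ 1 := inv_le_one_of_one_le₀ (le_add_of_nonneg_right zero_le)
    exact ENNReal.coe_le_one_iff.2 this
  · exact withDensity_absolutelyContinuous' hm.coe_nnreal_ennreal.aemeasurable
      (Eventually.of_forall fun s => by
        have : (1 + φ s)⁻¹ ≠ 0 := inv_ne_zero (by positivity)
        exact_mod_cast this)
  · rw [lintegral_withDensity_eq_lintegral_mul _ hm.coe_nnreal_ennreal hφ.coe_nnreal_ennreal]
    refine ne_of_lt ((lintegral_mono (g := fun _ => 1) fun s => ?_).trans_lt (by simp))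
    simp only [Pi.mul_apply]
    rw [← ENNReal.coe_mul]
    have : (1 + φ s)⁻¹ * φ s ≤ 1 := by
      rw [inv_mul_le_one₀ (by positivity)]
      exact le_add_of_nonneg_left zero_le_one
    exact_mod_cast this

end Liouville

/-! ### From minimality to loss of memory of the initial distribution. -/

section Liouville

variable {S : Type*} [MeasurableSpace S] {m : Measure S} {P : Kernel S S}

/-- The Liouville property of the Doob transform by a minimal harmonic function `φ`, in the form of
convergence of averages: for any sets `B n`, the numbers assigned to them by the Cesàro averages
have the same limits for all initial distributions. -/
theorem exists_tendsto_doobCesaro [SFinite m] (hP : m.bind P ≪ m) {φ : S → ℝ≥0}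
    (hφ : IsMinimalHarmonic m P φ) (B : ℕ → Set S) (hB : ∀ n, MeasurableSet (B n))
    (U : Ultrafilter ℕ) (hU : (U : Filter ℕ) ≤ atTop) :
    ∃ c : ℝ≥0, ∀ θ : Measure S, θ ≪ m → ∫⁻ s, (φ s : ℝ≥0∞) ∂θ = 1 →
      Tendsto (fun n => doobCesaro P φ θ n (B n)) U (𝓝 c) := by
  obtain ⟨⟨hφm, hφh⟩, -, hmin⟩ := hφ
  have hφm' : Measurable fun s => (φ s : ℝ≥0∞) := hφm.coe_nnreal_ennreal
  let f : ℕ → S → ℝ≥0∞ := fun n => (B n).indicator fun s => (φ s : ℝ≥0∞)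
  have hfm : ∀ n, Measurable (f n) := fun n => hφm'.indicator (hB n)
  have hfle : ∀ n s, f n s ≤ φ s := fun n s => Set.indicator_le_self _ _ s
  let H : ℕ → S → ℝ≥0∞ := fun n => truncatedPotentialFun P n (f n)
  have hHm : ∀ n, Measurable (H n) := fun n => measurable_truncatedPotentialFun n (hfm n)
  have hHle : ∀ n, ∀ᵐ s ∂m, H n s ≤ n * φ s := fun n =>
    ae_truncatedPotentialFun_le hP hφh (Eventually.of_forall (hfle n)) n
  -- `u n s` is the Cesàro average of the Doob transform started at `s`, evaluated on `B n`. The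
  -- truncation at `1` matters only on a null set, and where `n * φ s = 0` the potential `H n`
  -- vanishes almost everywhere too.
  let u : ℕ → S → ℝ≥0∞ := fun n s => min 1 (H n s / (n * φ s))
  have hum : ∀ n, Measurable (u n) := fun n =>
    measurable_const.min ((hHm n).div (hφm'.const_mul _))
  have huH : ∀ n, ∀ᵐ s ∂m, n * (φ s * u n s) = H n s := by
    intro n
    filter_upwards [hHle n] with s hs
    rcases eq_or_ne ((n : ℝ≥0∞) * φ s) 0 with h0 | h0
    · rw [← mul_assoc, h0, zero_mul]
      exact (nonpos_iff_eq_zero.1 (h0 ▸ hs)).symm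
    · have ht : (n : ℝ≥0∞) * φ s ≠ ∞ := ENNReal.mul_ne_top (by simp) (by simp)
      have h1 : u n s = H n s / (n * φ s) := min_eq_right (ENNReal.div_le_of_le_mul (by simpa))
      rw [h1, ← mul_assoc, ENNReal.mul_div_cancel h0 ht]
  obtain ⟨v, hvm, hvb, hlim⟩ := exists_weakStar_ultralimit_ennreal m U u hum
    fun n s => min_le_left _ _
  let ψ : S → ℝ≥0 := fun s => φ s * v s
  have hψm : Measurable ψ := hφm.mul hvm
  let a : Measure S → ℕ → ℝ≥0∞ := fun θ n => ∫⁻ s, φ s * u n s ∂θ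
  have ha : ∀ θ : Measure S, θ ≪ m → ∀ n : ℕ, n * a θ n = ∫⁻ s, H n s ∂θ := by
    intro θ hθ n
    exact (lintegral_const_mul _ (hφm'.mul (hum n))).symm.trans
      (lintegral_congr_ae (hθ.ae_le (huH n)))
  have halim : ∀ θ : Measure S, θ ≪ m → ∫⁻ s, (φ s : ℝ≥0∞) ∂θ ≠ ∞ →
      Tendsto (a θ) U (𝓝 (∫⁻ s, (ψ s : ℝ≥0∞) ∂θ)) := by
    intro θ hθ hfin
    have h := hlim (θ.withDensity fun s => (φ s : ℝ≥0∞)) (isFiniteMeasure_withDensity hfin)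
      ((withDensity_absolutelyContinuous _ _).trans hθ)
    rw [lintegral_withDensity_eq_lintegral_mul _ hφm' hvm.coe_nnreal_ennreal] at h
    simp only [ψ, ENNReal.coe_mul]
    refine h.congr fun n => ?_
    rw [lintegral_withDensity_eq_lintegral_mul _ hφm' (hum n)]
    rfl
  have hinv : ∀ θ : Measure S, θ ≪ m → ∫⁻ s, (φ s : ℝ≥0∞) ∂θ ≠ ∞ →
      ∫⁻ s, ∫⁻ t, (ψ t : ℝ≥0∞) ∂(P s) ∂θ = ∫⁻ s, (ψ s : ℝ≥0∞) ∂θ := by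
    intro θ hθ hfin
    have hθP := bind_absolutelyContinuous hP hθ
    have hfinP : ∫⁻ s, (φ s : ℝ≥0∞) ∂(θ.bind P) ≠ ∞ := by
      rwa [lintegral_bind_of_harmonic hθ hφm' hφh]
    rw [← Measure.lintegral_bind P.measurable.aemeasurable hψm.coe_nnreal_ennreal.aemeasurable]
    set C := ∫⁻ s, (φ s : ℝ≥0∞) ∂θ
    -- The telescoping identity integrated against `θ`. Both boundary terms are at most `C`, as `f
    -- n` and its iterates stay below `φ`, so the limits for `θ` and `θ.bind P` agree up to `C / n →
    -- 0`.
    have hsum : ∀ n : ℕ, n * a (θ.bind P) n + ∫⁻ s, f n s ∂θ =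
        n * a θ n + ∫⁻ s, iterateMarkov P n (f n) s ∂θ := by
      intro n
      rw [ha _ hθ, ha _ hθP, Measure.lintegral_bind P.measurable.aemeasurable
        (hHm n).aemeasurable, ← lintegral_add_right _ (hfm n),
        ← lintegral_add_right _ (measurable_iterateMarkov n (hfm n))]
      exact lintegral_congr fun s => lintegral_truncatedPotentialFun_add n (hfm n) s
    have hf1 : ∀ n, ∫⁻ s, f n s ∂θ ≤ C := fun n => lintegral_mono (hfle n)
    have hf2 : ∀ n, ∫⁻ s, iterateMarkov P n (f n) s ∂θ ≤ C := fun n => lintegral_mono_ae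
      (hθ.ae_le (ae_iterateMarkov_le hP hφh (Eventually.of_forall (hfle n)) n))
    have hdiv : ∀ {x y : ℝ≥0∞} {n : ℕ}, n ≠ 0 → n * x ≤ n * y + C → x ≤ y + C / n := by
      intro x y n hn h
      have hn' : (n : ℝ≥0∞) ≠ 0 := by simpa using hn
      rw [← ENNReal.mul_le_mul_iff_right hn' (ENNReal.natCast_ne_top n), mul_add,
        ENNReal.mul_div_cancel hn' (ENNReal.natCast_ne_top n)]
      exact h
    have hz : Tendsto (fun n : ℕ => C / n) U (𝓝 0) := by
      have := ENNReal.Tendsto.const_div (a := C) ENNReal.tendsto_nat_nhds_top (Or.inr hfin)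
      rw [ENNReal.div_top] at this
      exact this.mono_left hU
    have hne : ∀ᶠ n : ℕ in U, n ≠ 0 := hU (eventually_ne_atTop 0)
    refine le_antisymm ?_ ?_
    · have h := (halim θ hθ hfin).add hz
      rw [add_zero] at h
      refine le_of_tendsto_of_tendsto (halim _ hθP hfinP) h (hne.mono fun n hn => hdiv hn ?_)
      exact le_self_add.trans ((hsum n).trans_le (add_le_add_right (hf2 n) _))
    · have h := (halim _ hθP hfinP).add hz
      rw [add_zero] at h
      refine le_of_tendsto_of_tendsto (halim θ hθ hfin) h (hne.mono fun n hn => hdiv hn ?_)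
      exact le_self_add.trans ((hsum n).symm.trans_le (add_le_add_right (hf1 n) _))
  have hψh : IsHarmonic m P ψ := by
    -- Testing invariance on the restrictions of one measure equivalent to `m` recovers `P ψ = ψ`
    -- almost everywhere.
    obtain ⟨θ, hθ, hmθ, hθm, hfin⟩ := exists_equivalent_measure_lintegral_ne_top m hφm
    refine ⟨hψm, hmθ.ae_le ?_⟩
    refine ae_eq_of_forall_setLIntegral_eq_of_sigmaFinite
      hψm.coe_nnreal_ennreal.lintegral_kernel hψm.coe_nnreal_ennreal fun A hA _ => ?_
    refine hinv _ ((Measure.absolutelyContinuous_of_le Measure.restrict_le_self).trans hθm) ?_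
    exact ne_top_of_le_ne_top hfin (setLIntegral_le_lintegral _ _)
  -- Minimality enters here; `c` is found before any initial distribution is fixed.
  obtain ⟨c, hc⟩ := hmin ψ hψh (Eventually.of_forall fun s =>
    mul_le_of_le_one_right' (hvb s))
  refine ⟨c, fun θ hθ h1 => ?_⟩
  have hψc : ∫⁻ s, (ψ s : ℝ≥0∞) ∂θ = c := by
    have : ∫⁻ s, (ψ s : ℝ≥0∞) ∂θ = ∫⁻ s, c * (φ s : ℝ≥0∞) ∂θ := by
      refine lintegral_congr_ae ?_
      filter_upwards [hθ.ae_le hc] with s hs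
      rw [hs, ENNReal.coe_mul]
    rw [this, lintegral_const_mul _ hφm', h1, mul_one]
  have h := halim θ hθ (by simp [h1])
  rw [hψc] at h
  refine h.congr' ?_
  filter_upwards [hU (eventually_ne_atTop 0)] with n hn
  rw [doobCesaro_apply φ hφm θ n (hB n), ← ha θ hθ n, ← mul_assoc,
    ENNReal.inv_mul_cancel (by simpa using hn) (ENNReal.natCast_ne_top n), one_mul]

/-- For a minimal harmonic function `φ`, the Cesàro averages of the Doob transform are
asymptotically independent of the initial distribution in total variation. -/
theorem eventually_abs_doobCesaro_sub_le [SFinite m] (hP : m.bind P ≪ m) {φ : S → ℝ≥0}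
    (hφ : IsMinimalHarmonic m P φ) {θ θ' : Measure S} (hθ : θ ≪ m) (hθ' : θ' ≪ m)
    (h1 : ∫⁻ s, (φ s : ℝ≥0∞) ∂θ = 1) (h1' : ∫⁻ s, (φ s : ℝ≥0∞) ∂θ' = 1) {ε : ℝ} (hε : 0 < ε) :
    ∀ᶠ n in atTop, ∀ A, MeasurableSet A →
      |(doobCesaro P φ θ n).real A - (doobCesaro P φ θ' n).real A| ≤ ε := by
  by_contra hcon
  have hfreq : ∃ᶠ n in atTop, ∃ A, MeasurableSet A ∧
      ε < |(doobCesaro P φ θ n).real A - (doobCesaro P φ θ' n).real A| := by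
    refine (not_eventually.1 hcon).mono fun n hn => ?_
    push Not at hn
    exact hn
  let bad : Set ℕ := {n | ∃ A, MeasurableSet A ∧
    ε < |(doobCesaro P φ θ n).real A - (doobCesaro P φ θ' n).real A|}
  have hne : (atTop ⊓ 𝓟 bad).NeBot := frequently_mem_iff_neBot.1 hfreq
  -- The ultrafilter lives on the bad indices. With a witness of failure as `B n`, the common limit
  -- `c` for `θ` and `θ'` contradicts the gap `ε`.
  let U : Ultrafilter ℕ := Ultrafilter.of (atTop ⊓ 𝓟 bad)
  have hU : (U : Filter ℕ) ≤ atTop ⊓ 𝓟 bad := Ultrafilter.of_le _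
  have hex : ∀ n, ∃ A, MeasurableSet A ∧ (n ∈ bad →
      ε < |(doobCesaro P φ θ n).real A - (doobCesaro P φ θ' n).real A|) := by
    intro n
    by_cases hn : n ∈ bad
    · obtain ⟨A, hA, h⟩ := hn
      exact ⟨A, hA, fun _ => h⟩
    · exact ⟨∅, MeasurableSet.empty, fun h => absurd h hn⟩
  choose B hB hBε using hex
  obtain ⟨c, hc⟩ := exists_tendsto_doobCesaro hP hφ B hB U (hU.trans inf_le_left)
  have t := ((ENNReal.tendsto_toReal ENNReal.coe_ne_top).comp (hc θ hθ h1)).sub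
    ((ENNReal.tendsto_toReal ENNReal.coe_ne_top).comp (hc θ' hθ' h1'))
  rw [sub_self] at t
  have t' := t.abs
  rw [abs_zero] at t'
  have hbad : ∀ᶠ n in U, n ∈ bad := (hU.trans inf_le_right) (mem_principal_self bad)
  obtain ⟨n, hn1, hn2⟩ := ((t'.eventually (gt_mem_nhds hε)).and hbad).exists
  exact lt_asymm hn1 (hBε n hn2)

end Liouville

/-! ### Measurable dependence on `x` and equivariance of the averages. -/

section Construction

theorem exists_isProbabilityMeasure_absolutelyContinuous {Y : Type*} [MeasurableSpace Y]
    (m : Measure Y) [SFinite m] (hm : m ≠ 0) : ∃ ν : Measure Y, IsProbabilityMeasure ν ∧ ν ≪ m := by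
  obtain ⟨ν, hν, h1, h2⟩ := exists_isFiniteMeasure_absolutelyContinuous m
  have : NeZero ν := ⟨fun h => hm (Measure.absolutelyContinuous_zero_iff.1 (h ▸ h1))⟩
  exact ⟨(ν Set.univ)⁻¹ • ν, isProbabilityMeasureSMul, h2.smul_left _⟩

variable {G : Type*} [Group G] {S : Type*} [MeasurableSpace S] {m : Measure S} {P : Kernel S S}
  {X : Type*} [MeasurableSpace X]

/-- A measurable choice of initial distributions `θ x ≪ m` with `∫ φ x dθ x = 1`. -/
theorem exists_normalized_kernel (m : Measure S) [SFinite m] {φ : X → S → ℝ≥0}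
    (hφ : Measurable (Function.uncurry φ)) :
    ∃ θ : Kernel X S, IsSFiniteKernel θ ∧ ∀ x, θ x ≪ m ∧
      ((¬ ∀ᵐ s ∂m, φ x s = 0) → ∫⁻ s, (φ x s : ℝ≥0∞) ∂(θ x) = 1) := by
  obtain ⟨ν, hν, h1, h2⟩ := exists_isFiniteMeasure_absolutelyContinuous m
  let w : X → S → ℝ≥0 := fun x s => (1 + φ x s)⁻¹
  have hw : Measurable (Function.uncurry w) := (measurable_const.add hφ).inv
  have hφx : ∀ x, Measurable (φ x) := fun x => hφ.comp measurable_prodMk_left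
  let Z : X → ℝ≥0∞ := fun x => ∫⁻ s, (w x s * φ x s : ℝ≥0) ∂ν
  have hwφ : Measurable (Function.uncurry fun x s => w x s * φ x s) := hw.mul hφ
  have hwφx : ∀ x, Measurable fun s => ((w x s * φ x s : ℝ≥0) : ℝ≥0∞) := fun x =>
    (hwφ.comp measurable_prodMk_left).coe_nnreal_ennreal
  have hZm : Measurable Z := hwφ.coe_nnreal_ennreal.lintegral_prod_right'
  have hZt : ∀ x, Z x ≠ ∞ := fun x => by
    refine ne_of_lt ((lintegral_mono (g := fun _ => 1) fun s => ?_).trans_lt (by simp))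
    refine ENNReal.coe_le_one_iff.2 ?_
    rw [inv_mul_le_one₀ (by positivity)]
    exact le_add_of_nonneg_left zero_le_one
  -- If `Z x = 0` the inverse is `0` and so is the density; this happens only for `φ x` vanishing
  -- almost everywhere.
  let d : X → S → ℝ≥0 := fun x s => (Z x).toNNReal⁻¹ * w x s
  have hd : Measurable (Function.uncurry d) :=
    (hZm.ennreal_toNNReal.inv.comp measurable_fst).mul hw
  have hd' : Measurable (Function.uncurry fun x s => (d x s : ℝ≥0∞)) := hd.coe_nnreal_ennreal
  refine ⟨Kernel.withDensity (Kernel.const X ν) fun x s => (d x s : ℝ≥0∞), inferInstance,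
    fun x => ⟨?_, fun hx => ?_⟩⟩
  · rw [Kernel.withDensity_apply _ hd', Kernel.const_apply]
    exact (withDensity_absolutelyContinuous _ _).trans h2
  · have hZ0 : Z x ≠ 0 := by
      intro h0
      refine hx (h1.ae_le ?_)
      rw [lintegral_eq_zero_iff (hwφx x)] at h0
      filter_upwards [h0] with s hs
      have hs' : w x s * φ x s = 0 := ENNReal.coe_eq_zero.1 hs
      have : w x s ≠ 0 := inv_ne_zero (by positivity)
      exact (mul_eq_zero.1 hs').resolve_left this
    have hc : ((Z x).toNNReal : ℝ≥0∞) = Z x := ENNReal.coe_toNNReal (hZt x)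
    have hc0 : (Z x).toNNReal ≠ 0 := by simp [ENNReal.toNNReal_eq_zero_iff, hZ0, hZt x]
    rw [Kernel.lintegral_withDensity _ hd' _ (hφx x).coe_nnreal_ennreal, Kernel.const_apply]
    have : ∀ s, (d x s : ℝ≥0∞) * φ x s = ((Z x).toNNReal⁻¹ : ℝ≥0) * ((w x s * φ x s : ℝ≥0)) := by
      intro s
      rw [← ENNReal.coe_mul, ← ENNReal.coe_mul, mul_assoc]
    simp only [this]
    rw [lintegral_const_mul _ (hwφx x), ENNReal.coe_inv hc0, hc]
    exact ENNReal.inv_mul_cancel hZ0 (hZt x)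

theorem exists_kernel_truncatedPotential [IsSFiniteKernel P] (θ : Kernel X S) [IsSFiniteKernel θ]
    (n : ℕ) : ∃ K : Kernel X S, IsSFiniteKernel K ∧ ∀ x, K x = truncatedPotential P (θ x) n := by
  induction n with
  | zero => exact ⟨0, inferInstance, fun x => rfl⟩
  | succ n ih =>
    obtain ⟨K, hK, h⟩ := ih
    refine ⟨θ + P ∘ₖ K, inferInstance, fun x => ?_⟩
    rw [add_apply, Kernel.comp_apply, h]
    rfl

theorem measurable_doobCesaro [IsSFiniteKernel P] (θ : Kernel X S) [IsSFiniteKernel θ]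
    {φ : X → S → ℝ≥0} (hφ : Measurable (Function.uncurry φ)) (n : ℕ) :
    Measurable fun x => doobCesaro P (φ x) (θ x) n := by
  obtain ⟨K, hK, h⟩ := exists_kernel_truncatedPotential (P := P) θ n
  have hφ' : Measurable (Function.uncurry fun x s => (φ x s : ℝ≥0∞)) := hφ.coe_nnreal_ennreal
  have e : ∀ x, doobCesaro P (φ x) (θ x) n =
      (n : ℝ≥0∞)⁻¹ • Kernel.withDensity K (fun x s => (φ x s : ℝ≥0∞)) x := fun x => by
    rw [Kernel.withDensity_apply _ hφ', h, doobCesaro]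
  simp only [e]
  refine Measure.measurable_of_measurable_coe _ fun A hA => ?_
  simp only [Measure.smul_apply, smul_eq_mul]
  exact (Kernel.measurable_coe _ hA).const_mul _

theorem truncatedPotential_smul (θ : Measure S) (c : ℝ≥0∞) (n : ℕ) :
    truncatedPotential P (c • θ) n = c • truncatedPotential P θ n := by
  induction n with
  | zero => simp [truncatedPotential]
  | succ n ih => rw [truncatedPotential, ih, Measure.bind_smul, ← smul_add, truncatedPotential]

variable [MulAction G S]

theorem IsInvariantMarkov.map_bind [MeasurableConstSMul G S] (hP : IsInvariantMarkov G m P)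
    {θ : Measure S} (hθ : θ ≪ m) (g : G) :
    (θ.bind P).map (fun s => g • s) = (θ.map fun s => g • s).bind P := by
  have hg : Measurable fun s : S => g • s := measurable_const_smul g
  ext A hA
  rw [Measure.map_apply hg hA, Measure.bind_apply (hg hA) P.measurable.aemeasurable,
    Measure.bind_apply hA P.measurable.aemeasurable, lintegral_map (P.measurable_coe hA) hg]
  refine lintegral_congr_ae ?_
  filter_upwards [hθ.ae_le (hP.invariant g)] with s hs
  rw [hs, Measure.map_apply hg hA]

theorem IsInvariantMarkov.map_truncatedPotential [MeasurableConstSMul G S]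
    (hP : IsInvariantMarkov G m P) {θ : Measure S} (hθ : θ ≪ m) (g : G) (n : ℕ) :
    (truncatedPotential P θ n).map (fun s => g • s) =
      truncatedPotential P (θ.map fun s => g • s) n := by
  induction n with
  | zero => simp [truncatedPotential]
  | succ n ih =>
    rw [truncatedPotential, Measure.map_add _ _ (measurable_const_smul g), hP.map_bind
      (truncatedPotential_absolutelyContinuous hP.adapted hθ n), ih, truncatedPotential]

theorem map_absolutelyContinuous_of_invariant [MeasurableConstSMul G S] [SMulInvariantMeasure G S m]
    {θ : Measure S} (hθ : θ ≪ m) (g : G) : θ.map (fun s => g • s) ≪ m :=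
  (hθ.map (measurable_const_smul g)).trans
    (measurePreserving_smul g m).quasiMeasurePreserving.absolutelyContinuous

/-- The translate of a Cesàro average of a Doob transform is an average of the translated
transform. -/
theorem IsInvariantMarkov.map_doobCesaro [MeasurableConstSMul G S] (hP : IsInvariantMarkov G m P)
    {θ : Measure S} (hθ : θ ≪ m) {φ φ' : S → ℝ≥0} (hφ' : Measurable φ') (g : G) {c : ℝ≥0}
    (h : ∀ᵐ s ∂m, φ s = c * φ' (g • s)) (n : ℕ) :
    (doobCesaro P φ θ n).map (fun s => g • s) =
      doobCesaro P φ' ((c : ℝ≥0∞) • θ.map fun s => g • s) n := by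
  have hg : Measurable fun s : S => g • s := measurable_const_smul g
  have hK := truncatedPotential_absolutelyContinuous hP.adapted hθ n
  have hφg : Measurable fun s => (φ' (g • s) : ℝ≥0∞) := (hφ'.comp hg).coe_nnreal_ennreal
  rw [doobCesaro, doobCesaro, truncatedPotential_smul, ← hP.map_truncatedPotential hθ g n]
  ext A hA
  rw [Measure.map_apply hg hA, Measure.smul_apply, Measure.smul_apply,
    withDensity_apply _ (hg hA), withDensity_apply _ hA, Measure.restrict_smul,
    lintegral_smul_measure, setLIntegral_map hA hφ'.coe_nnreal_ennreal hg, smul_eq_mul (c : ℝ≥0∞),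
    ← lintegral_const_mul _ hφg]
  congr 1
  refine lintegral_congr_ae (ae_restrict_of_ae ?_)
  filter_upwards [hK.ae_le h] with s hs
  rw [hs, ENNReal.coe_mul]

/-- The form of projective equivariance needed by `IsInvariantMarkov.map_doobCesaro`, where the
scalar is absorbed into the initial distribution. -/
theorem exists_harmonic_smul_eq [MeasurableConstSMul G S] [SMulInvariantMeasure G S m] (g : G)
    {φ φ' : S → ℝ≥0} (h : ProjEq m φ' fun s => φ (g⁻¹ • s)) :
    ∃ c : ℝ≥0, ∀ᵐ s ∂m, φ s = c * φ' (g • s) := by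
  obtain ⟨c, hc, h⟩ := h
  refine ⟨c⁻¹, ?_⟩
  filter_upwards [(measurePreserving_smul g m).quasiMeasurePreserving.ae h] with s hs
  rw [hs, inv_smul_smul, inv_mul_cancel_left₀ hc.ne']

end Construction

/-! ### Right convolution on `G`. -/

section Convolution

variable {G : Type*} [Group G] [MeasurableSpace G] [MeasurableMul₂ G]

/-- Right convolution with a fixed measure does not increase the distance in total variation. -/
theorem abs_map_mul_sub_le {ν ν' η : Measure G} [IsProbabilityMeasure ν] [IsProbabilityMeasure ν']
    [IsProbabilityMeasure η] {ε : ℝ} (h : ∀ B, MeasurableSet B → |ν.real B - ν'.real B| ≤ ε)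
    {B : Set G} (hB : MeasurableSet B) :
    |((ν.prod η).map fun p => p.1 * p.2).real B - ((ν'.prod η).map fun p => p.1 * p.2).real B|
      ≤ ε := by
  have hm : Measurable fun p : G × G => p.1 * p.2 := by fun_prop
  have hsec : ∀ t, MeasurableSet {s : G | s * t ∈ B} := fun t => hB.preimage (by fun_prop)
  have hmeas : ∀ τ : Measure G, IsProbabilityMeasure τ →
      Measurable fun t => τ.real {s | s * t ∈ B} := fun τ _ =>
    (measurable_measure_prodMk_right (hm hB)).ennreal_toReal
  have e : ∀ τ : Measure G, IsProbabilityMeasure τ →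
      ((τ.prod η).map fun p => p.1 * p.2).real B = ∫ t, τ.real {s | s * t ∈ B} ∂η := by
    intro τ _
    rw [Measure.real, Measure.map_apply hm hB, Measure.prod_apply_symm (hm hB)]
    exact (integral_toReal (measurable_measure_prodMk_right (hm hB)).aemeasurable
      (Eventually.of_forall fun t => measure_lt_top _ _)).symm
  have hi : ∀ τ : Measure G, IsProbabilityMeasure τ →
      Integrable (fun t => τ.real {s | s * t ∈ B}) η := fun τ hτ =>
    integrable_of_abs_le (C := 1) (hmeas τ hτ) (Eventually.of_forall fun t => by
      simp [abs_of_nonneg, measureReal_le_one])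
  rw [e ν inferInstance, e ν' inferInstance, ← integral_sub (hi ν inferInstance)
    (hi ν' inferInstance)]
  simpa using integral_le_mul_measureReal (ν := η) (Eventually.of_forall fun t => h _ (hsec t))

/-- The convolution is a mixture of left translates of `η`, each absolutely continuous by left
invariance of `τ`; nothing is asked of `ν`. -/
theorem map_mul_absolutelyContinuous {ν η τ : Measure G} [SFinite ν] [SFinite η]
    [τ.IsMulLeftInvariant] (h : η ≪ τ) : (ν.prod η).map (fun p => p.1 * p.2) ≪ τ := by
  have hm : Measurable fun p : G × G => p.1 * p.2 := by fun_prop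
  refine Measure.AbsolutelyContinuous.mk fun B hB h0 => ?_
  rw [Measure.map_apply hm hB, Measure.prod_apply (hm hB)]
  have : ∀ s, η (Prod.mk s ⁻¹' ((fun p : G × G => p.1 * p.2) ⁻¹' B)) = 0 := fun s => h (by
    have := measure_preimage_mul τ s B
    rwa [h0] at this)
  simp [this]

theorem map_map_mul_left (ν η : Measure G) [SFinite ν] [SFinite η] (g : G) :
    ((ν.prod η).map fun p => p.1 * p.2).map (fun h => g * h) =
      ((ν.map fun h => g * h).prod η).map fun p => p.1 * p.2 := by
  have hg : Measurable fun h : G => g * h := measurable_const_mul g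
  have : (ν.map fun h => g * h).prod η = (ν.prod η).map (Prod.map (fun h => g * h) id) := by
    rw [← Measure.map_prod_map _ _ hg measurable_id, Measure.map_id]
  rw [this, Measure.map_map hg (by fun_prop), Measure.map_map (by fun_prop) (by fun_prop)]
  congr 1
  ext p
  simp [mul_assoc]

end Convolution

/-! ### Asymptotically equivariant measures on `S` and their lift to `G`. -/

section Construction

variable {G : Type*} [Group G]
  {S : Type*} [MeasurableSpace S] [MulAction G S] [MeasurableConstSMul G S]
  {X : Type*} [MeasurableSpace X] [MulAction G X]

/-- The Cesàro averages of the Doob transforms as measurable families of probability measures that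
are asymptotically equivariant in total variation. -/
theorem exists_asymptoticallyEquivariant (m : Measure S) [SFinite m] [SMulInvariantMeasure G S m]
    [Nonempty (AcProb m)] {P : Kernel S S} (hP : IsInvariantMarkov G m P) (μ : Measure X)
    (hμ : ∀ g : G, Measure.QuasiMeasurePreserving (fun x : X => g • x) μ μ)
    {φ : X → S → ℝ≥0} (hφ : Measurable (Function.uncurry φ))
    (hmin : ∀ᵐ x ∂μ, IsMinimalHarmonic m P (φ x))
    (hequiv : ∀ g : G, ∀ᵐ x ∂μ, ProjEq m (φ (g • x)) (fun s => φ x (g⁻¹ • s))) :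
    ∃ ν : ℕ → X → AcProb m, (∀ n, Measurable (ν n)) ∧ ∀ g : G, ∀ᵐ x ∂μ, ∀ ε : ℝ, 0 < ε →
      ∀ᶠ n in atTop, ∀ A, MeasurableSet A →
        |((ν n x).1.map (fun s => g • s)).real A - (ν n (g • x)).1.real A| ≤ ε := by
  have := hP.markov
  obtain ⟨θ, hθs, hθ⟩ := exists_normalized_kernel m hφ
  let ν₀ : AcProb m := Classical.arbitrary _
  let d : ℕ → X → Measure S := fun n x => doobCesaro P (φ x) (θ x) n
  have hd : ∀ n, Measurable (d n) := fun n => measurable_doobCesaro θ hφ n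
  have hdac : ∀ n x, d n x ≪ m := fun n x =>
    doobCesaro_absolutelyContinuous hP.adapted _ (hθ x).1 n
  let good : ℕ → Set X := fun n => {x | d n x Set.univ = 1}
  have hgood : ∀ n, MeasurableSet (good n) := fun n =>
    (Measure.measurable_coe MeasurableSet.univ).comp (hd n) (measurableSet_singleton 1)
  classical
  let ν' : ℕ → X → Measure S := fun n x => if x ∈ good n then d n x else ν₀.1
  -- The default `ν₀` covers `n = 0`, where the average is zero, and the exceptional `x`.
  have hν' : ∀ n x, IsProbabilityMeasure (ν' n x) ∧ ν' n x ≪ m := by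
    intro n x
    by_cases hx : x ∈ good n
    · simp only [ν', if_pos hx]
      exact ⟨⟨hx⟩, hdac n x⟩
    · simp only [ν', if_neg hx]
      exact ν₀.2
  refine ⟨fun n x => ⟨ν' n x, hν' n x⟩, fun n =>
    (Measurable.ite (hgood n) (hd n) measurable_const).subtype_mk, fun g => ?_⟩
  have hd1 : ∀ x, IsMinimalHarmonic m P (φ x) → ∀ n, n ≠ 0 → ν' n x = d n x := fun x hx n hn =>
    if_pos (doobCesaro_univ hP.adapted hx.1 (hθ x).1 ((hθ x).2 hx.2.1) hn)
  filter_upwards [hmin, (hμ g).ae hmin, hequiv g] with x hx hgx he ε hε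
  obtain ⟨c, hc⟩ := exists_harmonic_smul_eq g he
  have hac := (map_absolutelyContinuous_of_invariant (hθ x).1 g).smul_left (c : ℝ≥0∞)
  -- The translated average starts from `c • g θ x`, which is normalized for `φ (g • x)`; it can
  -- therefore be compared with the average started from `θ (g • x)`.
  have h1 : ∫⁻ s, (φ (g • x) s : ℝ≥0∞) ∂((c : ℝ≥0∞) • (θ x).map fun s => g • s) = 1 := by
    have hgm : Measurable fun s => (φ (g • x) (g • s) : ℝ≥0∞) :=
      (hgx.1.1.comp (measurable_const_smul g)).coe_nnreal_ennreal
    rw [lintegral_smul_measure, lintegral_map hgx.1.1.coe_nnreal_ennreal (measurable_const_smul g),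
      smul_eq_mul, ← lintegral_const_mul _ hgm, ← (hθ x).2 hx.2.1]
    refine lintegral_congr_ae ?_
    filter_upwards [(hθ x).1.ae_le hc] with s hs
    rw [hs, ENNReal.coe_mul]
  filter_upwards [eventually_abs_doobCesaro_sub_le hP.adapted hgx hac (hθ (g • x)).1 h1
    ((hθ (g • x)).2 hgx.2.1) hε, eventually_ne_atTop 0] with n hn hn0
  simp only [hd1 x hx n hn0, hd1 (g • x) hgx n hn0, d]
  rwa [hP.map_doobCesaro (hθ x).1 hgx.1.1 g hc n]

variable [TopologicalSpace G] [IsTopologicalGroup G]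
  [LocallyCompactSpace G] [SecondCountableTopology G] [MeasurableSpace G] [BorelSpace G]

/-- Lifting of asymptotically equivariant families of measures along a proper action. -/
theorem IsProperAction.exists_isAsymptoticallyInvariant {m : Measure S}
    [SMulInvariantMeasure G S m] (hproper : IsProperAction G m) {μ : Measure X}
    {ν : ℕ → X → AcProb m} (hν : ∀ n, Measurable (ν n))
    (h : ∀ g : G, ∀ᵐ x ∂μ, ∀ ε : ℝ, 0 < ε → ∀ᶠ n in atTop, ∀ A, MeasurableSet A →
      |((ν n x).1.map (fun s => g • s)).real A - (ν n (g • x)).1.real A| ≤ ε) :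
    ∃ κ : ℕ → Kernel X G, IsAsymptoticallyInvariant μ κ := by
  obtain ⟨L, hL, hLp, hLg, hLu⟩ := hproper
  -- The lift `L` need not give measures absolutely continuous with respect to Haar measure.
  -- Convolving on the right by `η` forces this and commutes with left translations.
  obtain ⟨η, hη, hηac⟩ := exists_isProbabilityMeasure_absolutelyContinuous
    (Measure.haar : Measure G) (NeZero.ne _)
  have hm : Measurable fun p : G × G => p.1 * p.2 := by fun_prop
  let K : ℕ → Kernel X G := fun n => ⟨fun x => L (ν n x), hL.comp (hν n)⟩
  have hK : ∀ n, IsMarkovKernel (K n) := fun n => ⟨fun x => hLp _⟩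
  let κ : ℕ → Kernel X G := fun n => (K n ×ₖ Kernel.const X η).map fun p => p.1 * p.2
  have hκ : ∀ n x, κ n x = ((L (ν n x)).prod η).map fun p => p.1 * p.2 := fun n x => by
    rw [Kernel.map_apply _ hm, Kernel.prod_apply, Kernel.const_apply]
    rfl
  refine ⟨κ, fun n => Kernel.IsMarkovKernel.map _ hm, fun n x => ?_, fun g => ?_⟩
  · have := hLp (ν n x)
    rw [hκ]
    exact map_mul_absolutelyContinuous hηac
  · filter_upwards [h g] with x hx ε hε
    obtain ⟨δ, hδ, hδε⟩ := hLu ε hε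
    filter_upwards [hx δ hδ] with n hn B hB
    have hp := (ν n x).2.1
    let gν : AcProb m := ⟨(ν n x).1.map fun s => g • s,
      Measure.isProbabilityMeasure_map (measurable_const_smul g).aemeasurable,
      map_absolutelyContinuous_of_invariant (ν n x).2.2 g⟩
    have h1 := hLp (ν n x)
    have h2 := hLp (ν n (g • x))
    have h3 := hLp gν
    rw [hκ, hκ, map_map_mul_left, ← hLg g (ν n x) gν rfl]
    exact abs_map_mul_sub_le (hδε gν (ν n (g • x)) hn) hB

end Construction

theorem mainTheorem6
    {G : Type*} [Group G] [TopologicalSpace G] [IsTopologicalGroup G] [T2Space G]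
    [LocallyCompactSpace G] [SecondCountableTopology G] [MeasurableSpace G] [BorelSpace G]
    {S : Type*} [MeasurableSpace S] [StandardBorelSpace S] [MulAction G S] [MeasurableSMul₂ G S]
    (m : Measure S) [SigmaFinite m] [SMulInvariantMeasure G S m]
    (hproper : IsProperAction G m)
    (P : Kernel S S) (hP : IsInvariantMarkov G m P)
    {X : Type*} [MeasurableSpace X] [StandardBorelSpace X] [MulAction G X] [MeasurableSMul₂ G X]
    (μ : Measure X) [SigmaFinite μ]
    (hμ : ∀ g : G, Measure.QuasiMeasurePreserving (fun x : X => g • x) μ μ)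
    (φ : X → S → ℝ≥0) (hφ : Measurable (Function.uncurry φ))
    (hmin : ∀ᵐ x ∂μ, IsMinimalHarmonic m P (φ x))
    (hequiv : ∀ g : G, ∀ᵐ x ∂μ, ProjEq m (φ (g • x)) (fun s => φ x (g⁻¹ • s))) :
    IsAmenableAction G μ := by
  rcases eq_or_ne μ 0 with rfl | hμ0
  -- For `μ = 0` no harmonic function is available to show `m ≠ 0`, but any constant family is
  -- vacuously asymptotically invariant.
  · obtain ⟨η, hη, hηac⟩ := exists_isProbabilityMeasure_absolutelyContinuous
      (Measure.haar : Measure G) (NeZero.ne _)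
    have hκ : IsAsymptoticallyInvariant (0 : Measure X) fun _ => Kernel.const X η :=
      ⟨fun _ => inferInstance, fun _ _ => hηac, fun g => by simp⟩
    exact hκ.isAmenableAction hμ
  · have : (ae μ).NeBot := ae_neBot.2 hμ0
    obtain ⟨x, hx⟩ := hmin.exists
    have hm0 : m ≠ 0 := by
      rintro rfl
      exact hx.2.1 (by simp)
    obtain ⟨ν₀, h₀⟩ := exists_isProbabilityMeasure_absolutelyContinuous m hm0
    have : Nonempty (AcProb m) := ⟨⟨ν₀, h₀⟩⟩
    obtain ⟨ν, hν, h⟩ := exists_asymptoticallyEquivariant m hP μ hμ hφ hmin hequiv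
    obtain ⟨κ, hκ⟩ := hproper.exists_isAsymptoticallyInvariant hν h
    exact hκ.isAmenableAction hμ
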